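/- **Pre-clipped Muon with hard clipping.** Let $m,n\ge 1$, $r=\min\{m,n\}$, $q=\max\{m,n\}$, $D=\sqrt{q/r}$. Let $f:\mathbb R^{m\times n}\to\mathbb R$ be differentiable, bounded below and $L$-smooth in the Frobenius norm for some $L>0$, i.e. $f(Y)\le f(X)+\langle\nabla f(X),Y-X\rangle+\frac L2\|Y-X\|_F^2$ for all $X,Y$. Fix $X_0\in\mathbb R^{m\times n}$ and put $\Delta=f(X_0)-\inf_X f(X)$. Let $B\ge 0$, $0\le\alpha\le1$, $\sigma\ge0$, $\gamma>0$, and let $$\tau\ge B+\max\Big\{\sigma\sqrt{2\log(16\sqrt r)},\ \frac{16\alpha\gamma\sqrt r}{\pi}\Big\},\qquad v_\tau=(1-\alpha)\sigma^2+\frac{4\alpha\gamma\tau}{\pi}.$$ For integers $T,N\ge1$ consider the iteration, for $0\le k<T$, $$G_k=\nabla f(X_k),\qquad \bar G_k=\frac1N\sum_{\ell=1}^N C_\tau\big(G_k+\Xi_k^{(\ell)}\big),\qquad X_{k+1}=X_k-\eta\,\mathrm{msign}(\bar G_k),\qquad \eta=\sqrt{\frac{2\Delta}{LrT}},$$ where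 $C_\tau(x)=x\min\{1,\tau/|x|\}$ (with $C_\tau(0)=0$) is applied entrywise and $\mathrm{msign}(M)=UV^{T}$ for a (reduced) singular value decomposition $M=U\Sigma V^{T}$ (any choice, if $M$ is rank deficient; the $X_k$ are random variables). Assume that: * almost surely $|(G_k)_{ij}|\le B$ for all $i,j$ and all $k<T$; * the noise matrices $\Xi_k^{(\ell)}$ ($k<T$, $\ell\le N$) are mutually independent, for each $k$ they are identically distributed in $\ell$, and $(\Xi_k^{(\ell)})_{\ell\le N}$ is independent of $X_k$; * each entry $(\Xi_k^{(\ell)})_{ij}$ has law $(1-\alpha)\,\mathcal N(0,s^2)+\alpha\,\mathrm{Cauchy}(0,c)$, with scales $0\le s\le\sigma$ and $0<c\le\gamma$ that may depend on $k,i,j$ (the entries of one matrix need not be independent). Then, with $\|\cdot\|_*$ the nuclear norm, each $\|G_k\|_*$, $k<T$, is integrable, and $$\frac1T\sum_{k=0}^{T-1}\mathbb E\|G_k\|_*\le 2\sqrt{\frac{2Lr\Delta}{T}}+4Dr^{3/2}\sqrt{\frac{v_\tau}{N}} .$$ Consequently, for every $\varepsilon>0$, if $T\ge 32Lr\Delta/\varepsilon^2$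 and $N\ge 64D^2r^3v_\tau/\varepsilon^2$, then $\frac1T\sum_{k=0}^{T-1}\mathbb E\|G_k\|_*\le\varepsilon$. In particular, there are choices $T=T(\varepsilon)\ge1$, $N=N(\varepsilon)\ge1$, depending only on $\varepsilon$ and the constants above, that guarantee this accuracy with a total number of samples $$TN\le\Big(\frac{32Lr\Delta}{\varepsilon^2}+1\Big)\Big(\frac{64D^2r^3v_\tau}{\varepsilon^2}+1\Big),$$ so that $TN=O(\varepsilon^{-4})$ as $\varepsilon\to0^+$ with the problem constants fixed. -/

import Mathlib

open MeasureTheory ProbabilityTheory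

/-- The product (Borel) σ-algebra on real matrices. -/
instance instMeasurableSpaceRealMatrix (m n : ℕ) :
    MeasurableSpace (Matrix (Fin m) (Fin n) ℝ) :=
  (MeasurableSpace.pi : MeasurableSpace (Fin m → Fin n → ℝ))

/-- The gradient `∇f(X)` as a matrix: the entry `(i, j)` is the derivative of `f` at `X` in the
direction of the elementary matrix `E_{ij}`. It represents the derivative of `f` for the Frobenius
inner product `⟨A, B⟩ = ∑ i j, A i j * B i j`. -/
noncomputable def matrixGradient {m n : ℕ} (f : Matrix (Fin m) (Fin n) ℝ → ℝ)
    (X : Matrix (Fin m) (Fin n) ℝ) : Matrix (Fin m) (Fin n) ℝ :=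
  Matrix.of fun i j => fderiv ℝ f X (Matrix.single i j 1)

/-- `f` is differentiable and satisfies
`f Y ≤ f X + ⟨∇f X, Y - X⟩ + (L / 2) ‖Y - X‖_F²` for all `X`, `Y`. -/
structure IsFrobeniusSmooth {m n : ℕ} (L : ℝ) (f : Matrix (Fin m) (Fin n) ℝ → ℝ) : Prop where
  differentiable : Differentiable ℝ f
  le_quadratic : ∀ X Y : Matrix (Fin m) (Fin n) ℝ,
    f Y ≤ f X + ∑ i, ∑ j, matrixGradient f X i j * (Y i j - X i j)
      + L / 2 * ∑ i, ∑ j, (Y i j - X i j) ^ 2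

/-- The nuclear norm `‖M‖_*`: the sum of the `min m n` singular values of `M`. -/
noncomputable def nuclearNorm {m n : ℕ} (M : Matrix (Fin m) (Fin n) ℝ) : ℝ :=
  ∑ i ∈ Finset.range (min m n), (Matrix.toEuclideanLin M).singularValues i

/-- `M = U Σ Vᵀ` is a (reduced) singular value decomposition: `U` and `V` have `p` orthonormal
columns and `Σ = diag(s)` with `s ≥ 0`. Both the thin form (`p = min m n`) and the compact form
(`p = rank M`, all `s i > 0`) are allowed. -/
structure IsSVD {m n p : ℕ} (M : Matrix (Fin m) (Fin n) ℝ) (U : Matrix (Fin m) (Fin p) ℝ)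
    (s : Fin p → ℝ) (V : Matrix (Fin n) (Fin p) ℝ) : Prop where
  left_orthonormal : U.transpose * U = 1
  right_orthonormal : V.transpose * V = 1
  nonneg : ∀ i, 0 ≤ s i
  eq_mul : M = U * Matrix.diagonal s * V.transpose

/-- `O` is a value of `msign M`, that is `O = U Vᵀ` for a singular value decomposition
`M = U Σ Vᵀ`. This is a relation because `U Vᵀ` may depend on the chosen decomposition when `M` is
rank deficient. -/
def IsMatrixSign {m n : ℕ} (M O : Matrix (Fin m) (Fin n) ℝ) : Prop :=
  ∃ (p : ℕ) (U : Matrix (Fin m) (Fin p) ℝ) (s : Fin p → ℝ) (V : Matrix (Fin n) (Fin p) ℝ),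
    IsSVD M U s V ∧ O = U * V.transpose

/-- Hard clipping `C_τ(x) = x min{1, τ / |x|}` (with `C_τ(0) = 0`). -/
noncomputable def hardClip (τ x : ℝ) : ℝ := x * min 1 (τ / |x|)

/-- The mixture `(1 - α) N(0, s²) + α Cauchy(0, c)`; here `N(0, 0)` is the Dirac mass at `0`. -/
noncomputable def gaussianCauchyMixture (α s c : ℝ) : Measure ℝ :=
  ENNReal.ofReal (1 - α) • gaussianReal 0 (s ^ 2).toNNReal
    + ENNReal.ofReal α • cauchyMeasure 0 c.toNNReal

/-- The mini-batch average `(1/N) ∑ ℓ, C_τ(G + Ξ ℓ)` of entrywise clipped noisy gradients. -/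
noncomputable def clippedBatch {m n N : ℕ} (τ : ℝ) (G : Matrix (Fin m) (Fin n) ℝ)
    (Ξ : Fin N → Matrix (Fin m) (Fin n) ℝ) : Matrix (Fin m) (Fin n) ℝ :=
  (N : ℝ)⁻¹ • ∑ ℓ, (G + Ξ ℓ).map (hardClip τ)

/-- The noise model for `T` iterations with `N` samples per iteration. `Ξ k ℓ` is the noise of the
sample `ℓ` at the iterate `X k`. Each entry follows the Gaussian-Cauchy mixture with (unknown)
local scales bounded by `σ` and `γ`; nothing is assumed about the joint law of the entries of one
noise matrix. The samples of one iteration are i.i.d., the noise is independent across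
iterations, and the batch used at the iterate `X k` is independent of `X k`. -/
structure IsNoiseModel {m n N : ℕ} {Ω : Type*} [MeasurableSpace Ω] (μ : Measure Ω)
    (α σ γ : ℝ) (T : ℕ) (X : ℕ → Ω → Matrix (Fin m) (Fin n) ℝ)
    (Ξ : ℕ → Fin N → Ω → Matrix (Fin m) (Fin n) ℝ) : Prop where
  measurable : ∀ k < T, ∀ ℓ, Measurable (Ξ k ℓ)
  entry_law : ∀ k < T, ∀ i j, ∃ s c : ℝ, 0 ≤ s ∧ s ≤ σ ∧ 0 < c ∧ c ≤ γ ∧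
    ∀ ℓ, μ.map (fun ω => Ξ k ℓ ω i j) = gaussianCauchyMixture α s c
  identDistrib : ∀ k < T, ∀ ℓ ℓ', IdentDistrib (Ξ k ℓ) (Ξ k ℓ') μ μ
  iIndep : iIndepFun (fun (p : Fin T × Fin N) => Ξ p.1 p.2) μ
  indep_iterate : ∀ k < T, IndepFun (X k) (fun ω ℓ => Ξ k ℓ ω) μ

/-- `X 0, …, X T` are the iterates of `T` iterations of
`X (k+1) = X k - η msign ((1/N) ∑ ℓ, C_τ(∇f(X k) + Ξ k ℓ))`, started at the deterministic
point `x₀`. -/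
structure IsPreClippedMuon {m n N : ℕ} {Ω : Type*} [MeasurableSpace Ω]
    (f : Matrix (Fin m) (Fin n) ℝ → ℝ) (x₀ : Matrix (Fin m) (Fin n) ℝ) (τ η : ℝ) (T : ℕ)
    (X : ℕ → Ω → Matrix (Fin m) (Fin n) ℝ)
    (Ξ : ℕ → Fin N → Ω → Matrix (Fin m) (Fin n) ℝ) : Prop where
  measurable : ∀ k ≤ T, Measurable (X k)
  init : ∀ ω, X 0 ω = x₀
  step : ∀ k < T, ∀ ω, ∃ O : Matrix (Fin m) (Fin n) ℝ,
    IsMatrixSign (clippedBatch τ (matrixGradient f (X k ω)) (fun ℓ => Ξ k ℓ ω)) O ∧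
      X (k + 1) ω = X k ω - η • O

/-- A run of the method under the noise model, along which the true gradients are bounded
entrywise by `B` (almost surely). -/
structure IsAdmissibleRun {m n N : ℕ} {Ω : Type*} [MeasurableSpace Ω] (μ : Measure Ω)
    (f : Matrix (Fin m) (Fin n) ℝ → ℝ) (x₀ : Matrix (Fin m) (Fin n) ℝ) (B α σ γ τ η : ℝ) (T : ℕ)
    (X : ℕ → Ω → Matrix (Fin m) (Fin n) ℝ)
    (Ξ : ℕ → Fin N → Ω → Matrix (Fin m) (Fin n) ℝ) : Prop where
  update : IsPreClippedMuon f x₀ τ η T X Ξ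
  noise : IsNoiseModel μ α σ γ T X Ξ
  gradient_bounded : ∀ k < T, ∀ᵐ ω ∂μ, ∀ i j, |matrixGradient f (X k ω) i j| ≤ B

/-- The average `(1/T) ∑_{k<T} E ‖∇f(X k)‖_*`. -/
noncomputable def averageNuclear {m n : ℕ} {Ω : Type*} [MeasurableSpace Ω] (μ : Measure Ω)
    (f : Matrix (Fin m) (Fin n) ℝ → ℝ) (T : ℕ)
    (X : ℕ → Ω → Matrix (Fin m) (Fin n) ℝ) : ℝ :=
  (T : ℝ)⁻¹ * ∑ k ∈ Finset.range T, ∫ ω, nuclearNorm (matrixGradient f (X k ω)) ∂μ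

/-!
The nuclear norm is dual to the set of matrix signs: every value `O` of `msign A` maximizes the
Frobenius pairing `⟨A, O⟩` among all partial isometries, and the maximum is `‖A‖_*`
(`IsMatrixSign.frobeniusInner_le`, `exists_isMatrixSign_frobeniusInner_eq_nuclearNorm`). Hence a
step along `msign` of an estimate `A'` of the gradient `A` loses at most `2 √r ‖A' - A‖_F` against
the ideal decrease `‖A‖_*` (`IsMatrixSign.nuclearNorm_sub_le_frobeniusInner`). This comparison
needs no nuclear norm of the error and works for every choice of the sign of a rank deficient
matrix.

The error splits into a bias and a fluctuation. Clipping is biased even under symmetric noise, and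
the bias does not vanish as `N` grows; but it is *relative*. As `E C_τ(ξ) = 0` by symmetry,
`E C_τ(g + ξ) - g` is the mean of `C_τ(g + ξ) - C_τ(ξ) - g`, which is at most `|g|` in absolute
value and vanishes unless `|ξ| > τ - B` (`abs_integral_hardClip_add_sub_le`). The lower bound on `τ`
makes this event so rare, by a Chernoff bound and by the Cauchy tail, that the bias is at most
`‖A‖_F / (4 √r) ≤ ‖A‖_* / (4 √r)`, so that it absorbs only half of the decrease
(`gaussianCauchyMixture_lt_abs_le`, `IsAdmissibleRun.ae_step_le`).

The fluctuation has variance at most `v / N` in each entry: clipping `g + ξ` at `τ` truncates `ξ`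
at `τ - g` and `-(τ + g)`, and the truncated second moment of a half of a Cauchy law is linear in
the truncation level, so that the two halves add up to `4 c τ / π` whatever `g` is
(`lintegral_sq_hardClip_add_sub_cauchyMeasure_le`). Independence of the batch and the iterate lets
one freeze the iterate (`lintegral_sq_average_hardClip_sub_le`).

Summing the descent inequality along almost every path and taking expectations afterwards
(`IsAdmissibleRun.mul_averageNuclear_le`) needs no integrability of `f (X k)`; the step size
balances the two deterministic terms. If `Δ = 0`, the step size is zero and the run stays at a
minimizer.
-/

/-! ### Hard clipping -/

lemma hardClip_eq_max_min {τ : ℝ} (hτ : 0 ≤ τ) (x : ℝ) :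
    hardClip τ x = max (-τ) (min τ x) := by
  unfold hardClip
  rcases lt_trichotomy x 0 with hx | rfl | hx
  · rw [abs_of_neg hx]
    rcases le_total (-x) τ with h | h
    · rw [min_eq_left ((one_le_div (by linarith)).2 h), min_eq_right (by linarith),
        max_eq_right (by linarith), mul_one]
    · rw [min_eq_right ((div_le_one (by linarith)).2 h), min_eq_right (by linarith),
        max_eq_left (by linarith), div_neg, mul_neg, mul_div_cancel₀ _ hx.ne]
  · simp [hτ]
  · rw [abs_of_pos hx]
    rcases le_total x τ with h | h
    · rw [min_eq_left ((one_le_div hx).2 h), min_eq_right h, max_eq_right (by linarith), mul_one]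
    · rw [min_eq_right ((div_le_one hx).2 h), min_eq_left h, max_eq_right (by linarith)]
      field_simp

lemma hardClip_neg (τ x : ℝ) : hardClip τ (-x) = -hardClip τ x := by
  simp [hardClip]

lemma hardClip_of_abs_le {τ x : ℝ} (h : |x| ≤ τ) : hardClip τ x = x := by
  rw [hardClip_eq_max_min ((abs_nonneg x).trans h), min_eq_right (abs_le.1 h).2,
    max_eq_right (abs_le.1 h).1]

lemma abs_hardClip_le {τ : ℝ} (hτ : 0 ≤ τ) (x : ℝ) : |hardClip τ x| ≤ τ := by
  rw [hardClip_eq_max_min hτ, abs_le]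
  exact ⟨le_max_left _ _, max_le (by linarith) (min_le_left _ _)⟩

lemma measurable_hardClip (τ : ℝ) : Measurable (hardClip τ) := by
  unfold hardClip
  fun_prop

lemma integrable_hardClip_comp {Ω : Type*} [MeasurableSpace Ω] {μ : Measure Ω} [IsFiniteMeasure μ]
    {τ : ℝ} (hτ : 0 ≤ τ) {Y : Ω → ℝ} (hY : Measurable Y) :
    Integrable (fun ω => hardClip τ (Y ω)) μ :=
  Integrable.of_bound ((measurable_hardClip τ).comp hY).aestronglyMeasurable τ
    (Filter.Eventually.of_forall fun _ => abs_hardClip_le hτ _)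

/-- Clipping moves two points apart by a fraction, between `0` and `1`, of their distance. -/
lemma abs_hardClip_add_sub_sub_le {τ : ℝ} (hτ : 0 ≤ τ) (g x : ℝ) :
    |hardClip τ (g + x) - hardClip τ x - g| ≤ |g| := by
  rw [hardClip_eq_max_min hτ, hardClip_eq_max_min hτ]
  rcases abs_cases g with ⟨h, _⟩ | ⟨h, _⟩ <;> rw [h, abs_le] <;>
    rcases max_cases (-τ) (min τ (g + x)) with ⟨h1, _⟩ | ⟨h1, _⟩ <;>
    rcases max_cases (-τ) (min τ x) with ⟨h2, _⟩ | ⟨h2, _⟩ <;>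
    rcases min_cases τ (g + x) with ⟨h3, _⟩ | ⟨h3, _⟩ <;>
    rcases min_cases τ x with ⟨h4, _⟩ | ⟨h4, _⟩ <;> constructor <;> linarith

/-- The clipping bias under symmetric noise is a small multiple of the signal: the clipped noise
itself is centred, and adding the signal `g` is distorted only when the noise exceeds `τ - B`. -/
lemma abs_integral_hardClip_add_sub_le {ν : Measure ℝ} [IsProbabilityMeasure ν]
    (hν : ν.map (fun x => -x) = ν) {τ B g : ℝ} (hτ : 0 ≤ τ) (hg : |g| ≤ B) :
    |∫ x, hardClip τ (g + x) ∂ν - g| ≤ ν.real {x | τ - B < |x|} * |g| := by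
  have hi1 : Integrable (fun x => hardClip τ (g + x)) ν :=
    integrable_hardClip_comp hτ (by fun_prop)
  have hi2 : Integrable (fun x => hardClip τ x) ν := integrable_hardClip_comp hτ measurable_id
  have h0 : ∫ x, hardClip τ x ∂ν = 0 := by
    have h : ∫ x, hardClip τ x ∂ν = -∫ x, hardClip τ x ∂ν := by
      conv_lhs => rw [← hν]
      rw [integral_map (by fun_prop) (measurable_hardClip τ).aestronglyMeasurable,
        ← integral_neg]
      simp only [hardClip_neg]
    linarith
  have hmeas : MeasurableSet {x : ℝ | τ - B < |x|} :=
    measurableSet_lt measurable_const measurable_id.norm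
  have heq : ∫ x, hardClip τ (g + x) ∂ν - g
      = ∫ x, (hardClip τ (g + x) - hardClip τ x - g) ∂ν := by
    rw [integral_sub (f := fun x => hardClip τ (g + x) - hardClip τ x) (hi1.sub hi2)
      (integrable_const _), integral_sub hi1 hi2, h0]
    simp
  rw [heq, ← Real.norm_eq_abs]
  calc ‖∫ x, (hardClip τ (g + x) - hardClip τ x - g) ∂ν‖
      ≤ ∫ x, ({x : ℝ | τ - B < |x|}.indicator (fun _ => |g|)) x ∂ν := by
        refine norm_integral_le_of_norm_le ((integrable_const _).indicator hmeas)
          (Filter.Eventually.of_forall fun x => ?_)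
        rw [Real.norm_eq_abs]
        by_cases hx : x ∈ {x : ℝ | τ - B < |x|}
        · rw [Set.indicator_of_mem hx]
          exact abs_hardClip_add_sub_sub_le hτ g x
        · rw [Set.indicator_of_notMem hx]
          have hx' : |x| ≤ τ - B := not_lt.1 hx
          have := abs_nonneg g
          rw [hardClip_of_abs_le (x := x) (by linarith),
            hardClip_of_abs_le ((abs_add_le g x).trans (by linarith))]
          simp
    _ = ν.real {x | τ - B < |x|} * |g| := by
        rw [integral_indicator_const _ hmeas, smul_eq_mul]

/-! ### The Cauchy distribution -/

lemma lintegral_eq_lintegral_Ioi_add_neg (F : ℝ → ENNReal) (hF : Measurable F) :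
    ∫⁻ x, F x = ∫⁻ x in Set.Ioi 0, (F x + F (-x)) := by
  rw [lintegral_add_left hF, ← lintegral_add_compl F (measurableSet_Ioi (a := (0 : ℝ)))]
  congr 1
  rw [Set.compl_Ioi, ← setLIntegral_congr (Iio_ae_eq_Iic (a := (0 : ℝ)) (μ := volume))]
  have h := (Measure.measurePreserving_neg (volume : Measure ℝ)).setLIntegral_comp_preimage
    (measurableSet_Iio (a := (0 : ℝ))) hF
  rw [← h]
  simp

lemma map_neg_cauchyMeasure (c : NNReal) :
    (cauchyMeasure 0 c).map (fun x => -x) = cauchyMeasure 0 c := by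
  by_cases hc : c = 0
  · simp [hc, Measure.map_dirac' measurable_neg]
  rw [cauchyMeasure_of_scale_ne_zero _ hc]
  ext s hs
  rw [Measure.map_apply measurable_neg hs, withDensity_apply _ (measurable_neg hs),
    withDensity_apply _ hs,
    ← (Measure.measurePreserving_neg (volume : Measure ℝ)).setLIntegral_comp_preimage hs
      (measurable_cauchyPDF 0 c)]
  simp [cauchyPDF, cauchyPDFReal]

lemma cauchyPDFReal_zero_neg (c : NNReal) (x : ℝ) :
    cauchyPDFReal 0 c (-x) = cauchyPDFReal 0 c x := by
  simp [cauchyPDFReal]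

lemma lintegral_Ioi_cauchyPDF_le (c : NNReal) {t : ℝ} (ht : 0 < t) :
    ∫⁻ x in Set.Ioi t, cauchyPDF 0 c x ≤ ENNReal.ofReal (c / (Real.pi * t)) := by
  have hint := integrableOn_Ioi_rpow_of_lt (a := -2) (by norm_num) ht
  have hval := integral_Ioi_rpow_of_lt (a := -2) (by norm_num) ht
  have h : ∫ x in Set.Ioi t, (c / Real.pi) * x ^ (-2 : ℝ) = c / (Real.pi * t) := by
    rw [integral_const_mul, hval]
    norm_num [Real.rpow_neg_one]
    field_simp
  rw [← h, ofReal_integral_eq_lintegral_ofReal (hint.const_mul _)]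
  · refine setLIntegral_mono' measurableSet_Ioi fun x hx => ENNReal.ofReal_le_ofReal ?_
    have hx0 : 0 < x := ht.trans hx
    rw [cauchyPDFReal, Real.rpow_neg hx0.le, Real.rpow_two, sub_zero, div_eq_inv_mul]
    gcongr
    nlinarith [sq_nonneg (c : ℝ)]
  · filter_upwards [ae_restrict_mem measurableSet_Ioi] with x hx
    have : 0 < x := ht.trans hx
    positivity

lemma cauchyMeasure_lt_abs_le {c : NNReal} (hc : c ≠ 0) {t : ℝ} (ht : 0 < t) :
    cauchyMeasure 0 c {x | t < |x|} ≤ ENNReal.ofReal (2 * c / (Real.pi * t)) := by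
  have hmeas : MeasurableSet {x : ℝ | t < |x|} :=
    measurableSet_lt measurable_const measurable_id.norm
  have hF : Measurable ({x : ℝ | t < |x|}.indicator (cauchyPDF 0 c)) :=
    (measurable_cauchyPDF 0 c).indicator hmeas
  rw [cauchyMeasure_of_scale_ne_zero _ hc, withDensity_apply _ hmeas,
    ← lintegral_indicator hmeas, lintegral_eq_lintegral_Ioi_add_neg _ hF]
  have h : ∀ x ∈ Set.Ioi (0 : ℝ), {x : ℝ | t < |x|}.indicator (cauchyPDF 0 c) x
      + {x : ℝ | t < |x|}.indicator (cauchyPDF 0 c) (-x)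
      = 2 * (Set.Ioi t).indicator (cauchyPDF 0 c) x := by
    intro x hx
    have hx : 0 < x := hx
    by_cases hxt : t < x
    · simp [Set.indicator, abs_of_pos hx, hxt, cauchyPDF, cauchyPDFReal_zero_neg, two_mul]
    · simp [Set.indicator, abs_of_pos hx, hxt]
  rw [setLIntegral_congr_fun measurableSet_Ioi h, lintegral_const_mul _
    ((measurable_cauchyPDF 0 c).indicator measurableSet_Ioi),
    setLIntegral_indicator measurableSet_Ioi, Set.inter_eq_left.2 (Set.Ioi_subset_Ioi ht.le)]
  calc 2 * ∫⁻ x in Set.Ioi t, cauchyPDF 0 c x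
      ≤ ENNReal.ofReal 2 * ENNReal.ofReal (c / (Real.pi * t)) := by
        rw [ENNReal.ofReal_ofNat]
        gcongr
        exact lintegral_Ioi_cauchyPDF_le c ht
    _ = ENNReal.ofReal (2 * c / (Real.pi * t)) := by
        rw [← ENNReal.ofReal_mul (by norm_num), mul_div_assoc]

/-- The truncated second moment of one half of a Cauchy law is linear in the truncation level. -/
lemma lintegral_Ioi_sq_min_mul_cauchyPDF_le (c : NNReal) {M : ℝ} (hM : 0 ≤ M) :
    ∫⁻ x in Set.Ioi 0, ENNReal.ofReal (min x M ^ 2) * cauchyPDF 0 c x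
      ≤ ENNReal.ofReal (2 * c * M / Real.pi) := by
  rcases hM.eq_or_lt with rfl | hM
  · rw [setLIntegral_congr_fun (g := fun _ => 0) measurableSet_Ioi]
    · simp
    · intro x hx
      simp [min_eq_right (Set.mem_Ioi.1 hx).le]
  rw [← Set.Ioc_union_Ioi_eq_Ioi hM.le, lintegral_union measurableSet_Ioi
    (Set.Ioc_disjoint_Ioi le_rfl)]
  have h1 : ∫⁻ x in Set.Ioc 0 M, ENNReal.ofReal (min x M ^ 2) * cauchyPDF 0 c x
      ≤ ENNReal.ofReal (c * M / Real.pi) := by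
    calc _ ≤ ∫⁻ _ in Set.Ioc 0 M, ENNReal.ofReal (c / Real.pi) := by
          refine setLIntegral_mono' measurableSet_Ioc fun x hx => ?_
          rw [cauchyPDF, ← ENNReal.ofReal_mul (by positivity)]
          refine ENNReal.ofReal_le_ofReal ?_
          rw [min_eq_left hx.2, cauchyPDFReal, sub_zero, div_eq_inv_mul]
          have hx0 := hx.1
          have h : x ^ 2 * (x ^ 2 + (c : ℝ) ^ 2)⁻¹ ≤ 1 := by
            rw [← div_eq_mul_inv, div_le_one (by positivity)]
            nlinarith [sq_nonneg (c : ℝ)]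
          calc x ^ 2 * (Real.pi⁻¹ * c * (x ^ 2 + (c : ℝ) ^ 2)⁻¹)
              = Real.pi⁻¹ * c * (x ^ 2 * (x ^ 2 + (c : ℝ) ^ 2)⁻¹) := by ring
            _ ≤ Real.pi⁻¹ * c * 1 := by gcongr
            _ = _ := mul_one _
      _ = ENNReal.ofReal (c * M / Real.pi) := by
          rw [setLIntegral_const, Real.volume_Ioc, sub_zero,
            ← ENNReal.ofReal_mul (by positivity)]
          congr 1
          ring
  have h2 : ∫⁻ x in Set.Ioi M, ENNReal.ofReal (min x M ^ 2) * cauchyPDF 0 c x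
      ≤ ENNReal.ofReal (c * M / Real.pi) := by
    calc _ = ∫⁻ x in Set.Ioi M, ENNReal.ofReal (M ^ 2) * cauchyPDF 0 c x := by
          refine setLIntegral_congr_fun measurableSet_Ioi fun x hx => ?_
          simp only [min_eq_right (Set.mem_Ioi.1 hx).le]
      _ ≤ ENNReal.ofReal (M ^ 2) * ENNReal.ofReal (c / (Real.pi * M)) := by
          rw [lintegral_const_mul _ (measurable_cauchyPDF 0 c)]
          gcongr
          exact lintegral_Ioi_cauchyPDF_le c hM
      _ = ENNReal.ofReal (c * M / Real.pi) := by
          rw [← ENNReal.ofReal_mul (by positivity)]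
          congr 1
          field_simp
  refine (add_le_add h1 h2).trans_eq ?_
  rw [← ENNReal.ofReal_add (by positivity) (by positivity)]
  congr 1
  ring

/-- Clipping `g + x` at level `τ` truncates the noise `x` at `τ - g` from above and at `-(τ + g)`
from below, so that the two halves contribute `2 c (τ ∓ g) / π` each. -/
lemma lintegral_sq_hardClip_add_sub_cauchyMeasure_le {c : NNReal} (hc : c ≠ 0) {τ g : ℝ}
    (hg : |g| ≤ τ) :
    ∫⁻ x, ENNReal.ofReal ((hardClip τ (g + x) - g) ^ 2) ∂cauchyMeasure 0 c
      ≤ ENNReal.ofReal (4 * c * τ / Real.pi) := by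
  obtain ⟨hg1, hg2⟩ := abs_le.1 hg
  have hτ : 0 ≤ τ := (abs_nonneg g).trans hg
  have hclip := measurable_hardClip τ
  have hF : Measurable fun x => ENNReal.ofReal ((hardClip τ (g + x) - g) ^ 2) := by fun_prop
  have hpdf := measurable_cauchyPDF 0 c
  rw [cauchyMeasure_of_scale_ne_zero _ hc, lintegral_withDensity_eq_lintegral_mul _ hpdf hF,
    lintegral_eq_lintegral_Ioi_add_neg _ (hpdf.mul hF)]
  have h : ∀ x ∈ Set.Ioi (0 : ℝ),
      (cauchyPDF 0 c * fun x => ENNReal.ofReal ((hardClip τ (g + x) - g) ^ 2)) x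
      + (cauchyPDF 0 c * fun x => ENNReal.ofReal ((hardClip τ (g + x) - g) ^ 2)) (-x)
      = ENNReal.ofReal (min x (τ - g) ^ 2) * cauchyPDF 0 c x
        + ENNReal.ofReal (min x (τ + g) ^ 2) * cauchyPDF 0 c x := by
    intro x hx
    have hx : 0 < x := hx
    have e1 : hardClip τ (g + x) - g = min x (τ - g) := by
      rw [hardClip_eq_max_min hτ, max_eq_right (le_min (by linarith) (by linarith))]
      rcases min_cases τ (g + x) with ⟨h3, _⟩ | ⟨h3, _⟩ <;>
        rcases min_cases x (τ - g) with ⟨h4, _⟩ | ⟨h4, _⟩ <;> linarith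
    have e2 : hardClip τ (g + -x) - g = -min x (τ + g) := by
      rw [hardClip_eq_max_min hτ, min_eq_right (by linarith)]
      rcases max_cases (-τ) (g + -x) with ⟨h3, _⟩ | ⟨h3, _⟩ <;>
        rcases min_cases x (τ + g) with ⟨h4, _⟩ | ⟨h4, _⟩ <;> linarith
    simp only [Pi.mul_apply, e1, e2, neg_sq]
    rw [mul_comm, mul_comm (cauchyPDF 0 c (-x)), cauchyPDF, cauchyPDF, cauchyPDFReal_zero_neg]
  rw [setLIntegral_congr_fun measurableSet_Ioi h, lintegral_add_left (by fun_prop)]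
  refine (add_le_add (lintegral_Ioi_sq_min_mul_cauchyPDF_le c (by linarith))
    (lintegral_Ioi_sq_min_mul_cauchyPDF_le c (by linarith))).trans_eq ?_
  have : 0 ≤ τ - g := by linarith
  have : 0 ≤ τ + g := by linarith
  rw [← ENNReal.ofReal_add (by positivity) (by positivity)]
  congr 1
  ring

/-! ### The Gaussian-Cauchy mixture -/

lemma gaussianReal_lt_abs_le (v : NNReal) {t : ℝ} (ht : 0 ≤ t) :
    gaussianReal 0 v {x | t < |x|} ≤ ENNReal.ofReal (2 * Real.exp (-t ^ 2 / (2 * v))) := by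
  have hsub : HasSubgaussianMGF id v (gaussianReal 0 v) :=
    { integrable_exp_mul := fun u => integrable_exp_mul_gaussianReal u
      mgf_le := fun u => by rw [mgf_id_gaussianReal]; simp }
  have h1 := hsub.measure_ge_le ht
  have h2 := hsub.neg.measure_ge_le ht
  have hsubset : {x : ℝ | t < |x|} ⊆ {x | t ≤ id x} ∪ {x | t ≤ (-id) x} := by
    intro x hx
    rcases abs_cases x with ⟨h, _⟩ | ⟨h, _⟩
    · left; have : t < |x| := hx; simp; linarith
    · right; have : t < |x| := hx; simp; linarith
  have h := (measureReal_mono hsubset).trans (measureReal_union_le (μ := gaussianReal 0 v) _ _)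
  rw [← ofReal_measureReal]
  exact ENNReal.ofReal_le_ofReal (by linarith)

/-- For `t` at least `σ √(2 log a)`, a centred Gaussian of scale at most `σ` exceeds `t` in absolute
value with probability at most `2 / a`. -/
lemma gaussianReal_lt_abs_le_two_div {s σ t a : ℝ} (hs : 0 ≤ s) (hsσ : s ≤ σ) (ha : 1 ≤ a)
    (ht : σ * √(2 * Real.log a) ≤ t) :
    gaussianReal 0 (s ^ 2).toNNReal {x | t < |x|} ≤ ENNReal.ofReal (2 / a) := by
  have ht0 : 0 ≤ t := (mul_nonneg (hs.trans hsσ) (Real.sqrt_nonneg _)).trans ht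
  have hlog : 0 ≤ Real.log a := Real.log_nonneg ha
  rcases hs.eq_or_lt with rfl | hs
  · have hmeas : MeasurableSet {x : ℝ | t < |x|} :=
      measurableSet_lt measurable_const measurable_id.norm
    rw [zero_pow two_ne_zero, Real.toNNReal_zero, gaussianReal_zero_var,
      Measure.dirac_apply' _ hmeas]
    simp [ht0]
  refine (gaussianReal_lt_abs_le _ ht0).trans (ENNReal.ofReal_le_ofReal ?_)
  rw [Real.coe_toNNReal _ (sq_nonneg s), div_eq_mul_inv 2 a]
  gcongr
  rw [← Real.exp_log (inv_pos.2 (show 0 < a by linarith)), Real.log_inv]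
  apply Real.exp_le_exp.2
  rw [neg_div, neg_le_neg_iff, le_div_iff₀ (by positivity)]
  have h := pow_le_pow_left₀ (by positivity) ((mul_le_mul_of_nonneg_right hsσ
    (Real.sqrt_nonneg (2 * Real.log a))).trans ht) 2
  rw [mul_pow, Real.sq_sqrt (by positivity)] at h
  linarith

lemma lintegral_gaussianCauchyMixture (α s c : ℝ) (F : ℝ → ENNReal) :
    ∫⁻ x, F x ∂gaussianCauchyMixture α s c
      = ENNReal.ofReal (1 - α) * ∫⁻ x, F x ∂gaussianReal 0 (s ^ 2).toNNReal
        + ENNReal.ofReal α * ∫⁻ x, F x ∂cauchyMeasure 0 c.toNNReal := by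
  rw [gaussianCauchyMixture, lintegral_add_measure, lintegral_smul_measure,
    lintegral_smul_measure, smul_eq_mul, smul_eq_mul]

lemma map_neg_gaussianCauchyMixture (α s c : ℝ) :
    (gaussianCauchyMixture α s c).map (fun x => -x) = gaussianCauchyMixture α s c := by
  rw [gaussianCauchyMixture, Measure.map_add _ _ measurable_neg, Measure.map_smul,
    Measure.map_smul, gaussianReal_map_neg, neg_zero, map_neg_cauchyMeasure]

/-- The clipping level is chosen so that each of the two components contributes at most
`1 / (8 √r)` to the tail. -/
lemma gaussianCauchyMixture_lt_abs_le {α s c σ γ r t : ℝ} (hα : 0 ≤ α) (hα' : α ≤ 1) (hs : 0 ≤ s)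
    (hsσ : s ≤ σ) (hc : 0 < c) (hcγ : c ≤ γ) (hr : 1 ≤ r)
    (ht : max (σ * √(2 * Real.log (16 * √r))) (16 * α * γ * √r / Real.pi) ≤ t) :
    gaussianCauchyMixture α s c {x | t < |x|} ≤ ENNReal.ofReal (1 / (4 * √r)) := by
  have hsr : 1 ≤ √r := Real.one_le_sqrt.2 hr
  have hG := gaussianReal_lt_abs_le_two_div hs hsσ (show 1 ≤ 16 * √r by linarith)
    ((le_max_left _ _).trans ht)
  have ht2 := (le_max_right _ _).trans ht
  have hC : ENNReal.ofReal α * cauchyMeasure 0 c.toNNReal {x | t < |x|}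
      ≤ ENNReal.ofReal (1 / (8 * √r)) := by
    rcases hα.eq_or_lt with rfl | hα
    · simp
    have hγ : 0 < γ := hc.trans_le hcγ
    have hpi := Real.pi_pos
    have ht0 : 0 < t := lt_of_lt_of_le (by positivity) ht2
    grw [cauchyMeasure_lt_abs_le (by simpa using hc) ht0]
    rw [← ENNReal.ofReal_mul hα.le, Real.coe_toNNReal _ hc.le]
    apply ENNReal.ofReal_le_ofReal
    rw [div_le_iff₀ hpi] at ht2
    rw [← mul_div_assoc, div_le_div_iff₀ (by positivity) (by positivity)]
    calc α * (2 * c) * (8 * √r) = 16 * α * c * √r := by ring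
      _ ≤ 16 * α * γ * √r := by gcongr
      _ ≤ 1 * (Real.pi * t) := by linarith
  have hsum : gaussianCauchyMixture α s c {x | t < |x|}
      = ENNReal.ofReal (1 - α) * gaussianReal 0 (s ^ 2).toNNReal {x | t < |x|}
        + ENNReal.ofReal α * cauchyMeasure 0 c.toNNReal {x | t < |x|} := by
    simp [gaussianCauchyMixture]
  rw [hsum]
  calc _ ≤ 1 * ENNReal.ofReal (2 / (16 * √r)) + ENNReal.ofReal (1 / (8 * √r)) := by
        gcongr
        exact ENNReal.ofReal_le_one.2 (by linarith)
    _ = ENNReal.ofReal (1 / (4 * √r)) := by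
        rw [one_mul, ← ENNReal.ofReal_add (by positivity) (by positivity)]
        congr 1
        field_simp
        norm_num

lemma abs_hardClip_add_sub_le {τ g : ℝ} (hg : |g| ≤ τ) (x : ℝ) :
    |hardClip τ (g + x) - g| ≤ |x| := by
  obtain ⟨hg1, hg2⟩ := abs_le.1 hg
  rw [hardClip_eq_max_min ((abs_nonneg g).trans hg)]
  rcases abs_cases x with ⟨h, _⟩ | ⟨h, _⟩ <;> rw [h, abs_le] <;>
    rcases max_cases (-τ) (min τ (g + x)) with ⟨h1, _⟩ | ⟨h1, _⟩ <;>
    rcases min_cases τ (g + x) with ⟨h3, _⟩ | ⟨h3, _⟩ <;> constructor <;> linarith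

lemma lintegral_sq_hardClip_add_sub_gaussianReal_le (v : NNReal) {τ g : ℝ} (hg : |g| ≤ τ) :
    ∫⁻ x, ENNReal.ofReal ((hardClip τ (g + x) - g) ^ 2) ∂gaussianReal 0 v ≤ v := by
  have hint : Integrable (fun x : ℝ => x ^ 2) (gaussianReal 0 v) :=
    (memLp_id_gaussianReal 2).integrable_sq
  have hvar := variance_id_gaussianReal (μ := 0) (v := v)
  rw [variance_eq_integral aemeasurable_id] at hvar
  simp only [id_eq, integral_id_gaussianReal, sub_zero] at hvar
  calc _ ≤ ∫⁻ x, ENNReal.ofReal (x ^ 2) ∂gaussianReal 0 v := by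
        refine lintegral_mono fun x => ENNReal.ofReal_le_ofReal ?_
        exact sq_le_sq.2 (abs_hardClip_add_sub_le hg x)
    _ = v := by
        rw [← ofReal_integral_eq_lintegral_ofReal hint
          (Filter.Eventually.of_forall fun x => sq_nonneg x), hvar, ENNReal.ofReal_coe_nnreal]

lemma lintegral_sq_hardClip_add_sub_gaussianCauchyMixture_le {α s c σ γ τ g : ℝ} (hα : 0 ≤ α)
    (hα' : α ≤ 1) (hs : 0 ≤ s) (hsσ : s ≤ σ) (hc : 0 < c) (hcγ : c ≤ γ) (hg : |g| ≤ τ) :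
    ∫⁻ x, ENNReal.ofReal ((hardClip τ (g + x) - g) ^ 2) ∂gaussianCauchyMixture α s c
      ≤ ENNReal.ofReal ((1 - α) * σ ^ 2 + 4 * α * γ * τ / Real.pi) := by
  have hτ : 0 ≤ τ := (abs_nonneg g).trans hg
  have hγ : 0 < γ := hc.trans_le hcγ
  have hα1 : 0 ≤ 1 - α := by linarith
  have hpi := Real.pi_pos
  rw [lintegral_gaussianCauchyMixture, ENNReal.ofReal_add (by positivity) (by positivity)]
  gcongr ?_ + ?_
  · rw [ENNReal.ofReal_mul hα1]
    gcongr
    refine (lintegral_sq_hardClip_add_sub_gaussianReal_le _ hg).trans ?_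
    exact ENNReal.ofReal_le_ofReal (by gcongr)
  · grw [lintegral_sq_hardClip_add_sub_cauchyMeasure_le (by simpa using hc) hg]
    rw [← ENNReal.ofReal_mul hα, Real.coe_toNNReal _ hc.le]
    apply ENNReal.ofReal_le_ofReal
    calc α * (4 * c * τ / Real.pi) = 4 * α * c * τ / Real.pi := by ring
      _ ≤ 4 * α * γ * τ / Real.pi := by gcongr

/-! ### Mini-batch averages -/

lemma variance_le_of_lintegral_sq_sub_le {Ω : Type*} [MeasurableSpace Ω] {μ : Measure Ω}
    [IsProbabilityMeasure μ] {Y : Ω → ℝ} (hY : MemLp Y 2 μ) {g v : ℝ} (hv : 0 ≤ v)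
    (h : ∫⁻ ω, ENNReal.ofReal ((Y ω - g) ^ 2) ∂μ ≤ ENNReal.ofReal v) :
    Var[Y; μ] ≤ v := by
  have hYg : MemLp (fun ω => Y ω - g) 2 μ := hY.sub (memLp_const g)
  rw [← variance_sub_const hY.aestronglyMeasurable g]
  refine (variance_le_expectation_sq hYg.aestronglyMeasurable).trans ?_
  rw [← ENNReal.ofReal_le_ofReal_iff hv]
  refine le_trans (le_of_eq ?_) h
  exact ofReal_integral_eq_lintegral_ofReal hYg.integrable_sq
    (Filter.Eventually.of_forall fun _ => sq_nonneg _)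

lemma lintegral_sq_average_sub_le {Ω : Type*} [MeasurableSpace Ω] {μ : Measure Ω}
    [IsProbabilityMeasure μ] {N : ℕ} (hN : 0 < N) {Y : Fin N → Ω → ℝ}
    (hY : ∀ l, MemLp (Y l) 2 μ) (hind : Pairwise fun l l' => IndepFun (Y l) (Y l') μ)
    {a v : ℝ} (hmean : ∀ l, ∫ ω, Y l ω ∂μ = a) (hvar : ∀ l, Var[Y l; μ] ≤ v) :
    ∫⁻ ω, ENNReal.ofReal (((N : ℝ)⁻¹ * ∑ l, Y l ω - a) ^ 2) ∂μ ≤ ENNReal.ofReal (v / N) := by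
  have hN' : (0 : ℝ) < N := by exact_mod_cast hN
  have hS : MemLp (fun ω => ∑ l, Y l ω) 2 μ := memLp_finsetSum _ fun l _ => hY l
  have hZ : MemLp (fun ω => (N : ℝ)⁻¹ * ∑ l, Y l ω) 2 μ := hS.const_mul _
  have hEZ : ∫ ω, (N : ℝ)⁻¹ * ∑ l, Y l ω ∂μ = a := by
    rw [integral_const_mul, integral_finsetSum _ fun l _ => (hY l).integrable one_le_two]
    simp [hmean, hN'.ne']
  have hEV : ∫⁻ ω, ENNReal.ofReal (((N : ℝ)⁻¹ * ∑ l, Y l ω - a) ^ 2) ∂μ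
      = ENNReal.ofReal (Var[fun ω => (N : ℝ)⁻¹ * ∑ l, Y l ω; μ]) := by
    rw [variance_eq_integral hZ.aemeasurable, hEZ]
    exact (ofReal_integral_eq_lintegral_ofReal
      (hZ.sub (memLp_const a)).integrable_sq
      (Filter.Eventually.of_forall fun _ => sq_nonneg _)).symm
  rw [hEV, variance_const_mul]
  apply ENNReal.ofReal_le_ofReal
  have hsum : Var[fun ω => ∑ l, Y l ω; μ] = ∑ l, Var[Y l; μ] := by
    have := IndepFun.variance_sum (s := Finset.univ) (fun l _ => hY l)
      (fun i _ j _ hij => hind hij)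
    rw [← this]
    congr 1
    ext ω
    simp
  rw [hsum]
  calc ((N : ℝ)⁻¹) ^ 2 * ∑ l, Var[Y l; μ] ≤ ((N : ℝ)⁻¹) ^ 2 * ∑ _l : Fin N, v := by
        gcongr with l
        exact hvar l
    _ = v / N := by
        simp
        field_simp

/-! ### Singular value decompositions and the nuclear norm -/

/-- The Frobenius inner product of two real matrices. -/
def frobeniusInner {m n : ℕ} (A B : Matrix (Fin m) (Fin n) ℝ) : ℝ := ∑ i, ∑ j, A i j * B i j

/-- The Frobenius norm of a real matrix. -/
noncomputable def frobeniusNorm {m n : ℕ} (A : Matrix (Fin m) (Fin n) ℝ) : ℝ :=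
  √(∑ i, ∑ j, A i j ^ 2)

section Frobenius
variable {m n : ℕ} (A B C : Matrix (Fin m) (Fin n) ℝ)

lemma frobeniusInner_eq_trace : frobeniusInner A B = (A.transpose * B).trace := by
  simp only [frobeniusInner, Matrix.trace, Matrix.diag, Matrix.mul_apply, Matrix.transpose_apply]
  exact Finset.sum_comm

lemma frobeniusInner_sub_left :
    frobeniusInner (A - B) C = frobeniusInner A C - frobeniusInner B C := by
  simp [frobeniusInner, sub_mul, Finset.sum_sub_distrib]

lemma frobeniusInner_sub_right :
    frobeniusInner A (B - C) = frobeniusInner A B - frobeniusInner A C := by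
  simp [frobeniusInner, mul_sub, Finset.sum_sub_distrib]

lemma frobeniusNorm_nonneg : 0 ≤ frobeniusNorm A := Real.sqrt_nonneg _

lemma frobeniusNorm_sq : frobeniusNorm A ^ 2 = ∑ i, ∑ j, A i j ^ 2 :=
  Real.sq_sqrt (Finset.sum_nonneg fun _ _ => Finset.sum_nonneg fun _ _ => sq_nonneg _)

lemma frobeniusNorm_eq_norm :
    frobeniusNorm A = ‖WithLp.toLp 2 (fun x : Fin m × Fin n => A x.1 x.2)‖ := by
  rw [EuclideanSpace.norm_eq, frobeniusNorm, Fintype.sum_prod_type]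
  simp

lemma frobeniusNorm_sub_comm : frobeniusNorm (A - B) = frobeniusNorm (B - A) := by
  simp only [frobeniusNorm, Matrix.sub_apply, sub_sq_comm (A _ _)]

lemma frobeniusNorm_add_le : frobeniusNorm (A + B) ≤ frobeniusNorm A + frobeniusNorm B := by
  simp only [frobeniusNorm_eq_norm]
  exact norm_add_le (WithLp.toLp 2 fun x : Fin m × Fin n => A x.1 x.2)
    (WithLp.toLp 2 fun x : Fin m × Fin n => B x.1 x.2)

lemma frobeniusNorm_sub_le_add : frobeniusNorm (A - B) ≤ frobeniusNorm A + frobeniusNorm B := by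
  simp only [frobeniusNorm_eq_norm]
  exact norm_sub_le (WithLp.toLp 2 fun x : Fin m × Fin n => A x.1 x.2)
    (WithLp.toLp 2 fun x : Fin m × Fin n => B x.1 x.2)

lemma frobeniusInner_le : frobeniusInner A B ≤ frobeniusNorm A * frobeniusNorm B := by
  simp only [frobeniusNorm_eq_norm]
  refine le_trans (le_of_eq ?_) (real_inner_le_norm
    (WithLp.toLp 2 fun x : Fin m × Fin n => A x.1 x.2)
    (WithLp.toLp 2 fun x : Fin m × Fin n => B x.1 x.2))
  simp [frobeniusInner, PiLp.inner_apply, Fintype.sum_prod_type, mul_comm]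

end Frobenius

section SVD
variable {m n p q : ℕ} {M : Matrix (Fin m) (Fin n) ℝ}
  {U : Matrix (Fin m) (Fin p) ℝ} {s : Fin p → ℝ} {V : Matrix (Fin n) (Fin p) ℝ}
  {U' : Matrix (Fin m) (Fin q) ℝ} {V' : Matrix (Fin n) (Fin q) ℝ}

lemma card_le_of_transpose_mul_self_eq_one (hU : U.transpose * U = 1) : p ≤ m := by
  have h1 : (U.transpose * U).rank = p := by rw [hU, Matrix.rank_one, Fintype.card_fin]
  have h2 := Matrix.rank_mul_le_right U.transpose U
  have h3 := Matrix.rank_le_card_height U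
  rw [Fintype.card_fin] at h3
  omega

/-- Bessel's inequality for a vector and a family that are both columns of matrices with
orthonormal columns. -/
lemma sum_sq_transpose_mul_le_one (hU : U.transpose * U = 1) (hU' : U'.transpose * U' = 1)
    (i : Fin p) : ∑ a, (U.transpose * U') i a ^ 2 ≤ 1 := by
  -- The residual of the orthogonal projection of `U` on the column space of `U'`.
  set P := U.transpose * U' with hP
  have hPt : U'.transpose * U = P.transpose := by
    rw [hP, Matrix.transpose_mul, Matrix.transpose_transpose]
  have h : (U - U' * P.transpose).transpose * (U - U' * P.transpose) = 1 - P * P.transpose := by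
    rw [Matrix.transpose_sub, Matrix.transpose_mul, Matrix.transpose_transpose, Matrix.sub_mul,
      Matrix.mul_sub, Matrix.mul_sub, hU, ← Matrix.mul_assoc U.transpose, ← hP,
      Matrix.mul_assoc P, hPt, Matrix.mul_assoc P, ← Matrix.mul_assoc U'.transpose, hU',
      Matrix.one_mul, sub_self, sub_zero]
  have h0 : 0 ≤ ((U - U' * P.transpose).transpose * (U - U' * P.transpose)) i i := by
    rw [Matrix.mul_apply]
    exact Finset.sum_nonneg fun _ _ => mul_self_nonneg _
  rw [h, Matrix.sub_apply, Matrix.one_apply_eq, Matrix.mul_apply] at h0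
  simp only [Matrix.transpose_apply, ← sq] at h0
  linarith

lemma frobeniusInner_mul_transpose_self (hU : U.transpose * U = 1) (hV : V.transpose * V = 1) :
    frobeniusInner (U * V.transpose) (U * V.transpose) = p := by
  rw [frobeniusInner_eq_trace, Matrix.transpose_mul, Matrix.transpose_transpose,
    Matrix.mul_assoc, ← Matrix.mul_assoc U.transpose, hU, Matrix.one_mul, Matrix.trace_mul_comm,
    hV, Matrix.trace_one, Fintype.card_fin]

lemma IsSVD.frobeniusInner_self (h : IsSVD M U s V) : frobeniusInner M M = ∑ i, s i ^ 2 := by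
  rw [frobeniusInner_eq_trace, h.eq_mul, Matrix.transpose_mul, Matrix.transpose_mul,
    Matrix.transpose_transpose, Matrix.mul_assoc, Matrix.mul_assoc, Matrix.mul_assoc U,
    ← Matrix.mul_assoc U.transpose, h.left_orthonormal, Matrix.one_mul, Matrix.trace_mul_comm,
    Matrix.mul_assoc, Matrix.mul_assoc, h.right_orthonormal, Matrix.mul_one,
    Matrix.diagonal_transpose, Matrix.diagonal_mul_diagonal, Matrix.trace_diagonal]
  simp only [sq]

lemma IsSVD.frobeniusInner_mul_transpose (h : IsSVD M U s V) :
    frobeniusInner M (U' * V'.transpose)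
      = ∑ i, s i * ∑ a, (U.transpose * U') i a * (V.transpose * V') i a := by
  rw [frobeniusInner_eq_trace, h.eq_mul, Matrix.transpose_mul, Matrix.transpose_mul,
    Matrix.transpose_transpose, Matrix.mul_assoc, Matrix.trace_mul_comm, Matrix.mul_assoc,
    Matrix.mul_assoc, ← Matrix.mul_assoc U.transpose, Matrix.mul_assoc U.transpose,
    Matrix.diagonal_transpose, Matrix.trace]
  refine Finset.sum_congr rfl fun i (_ : i ∈ Finset.univ) => ?_
  rw [Matrix.diag_apply, Matrix.diagonal_mul, Matrix.mul_assoc U', ← Matrix.mul_assoc U.transpose,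
    Matrix.mul_apply]
  congr 1
  refine Finset.sum_congr rfl fun a _ => ?_
  congr 1
  rw [← Matrix.transpose_apply (V.transpose * V'), Matrix.transpose_mul, Matrix.transpose_transpose]

lemma IsSVD.frobeniusInner_sign (h : IsSVD M U s V) :
    frobeniusInner M (U * V.transpose) = ∑ i, s i := by
  rw [h.frobeniusInner_mul_transpose, h.left_orthonormal, h.right_orthonormal]
  simp [Matrix.one_apply]

/-- The sum of the singular values bounds the pairing with every partial isometry. -/
lemma IsSVD.frobeniusInner_mul_transpose_le (h : IsSVD M U s V) (hU' : U'.transpose * U' = 1)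
    (hV' : V'.transpose * V' = 1) : frobeniusInner M (U' * V'.transpose) ≤ ∑ i, s i := by
  rw [h.frobeniusInner_mul_transpose]
  refine Finset.sum_le_sum fun i _ => mul_le_of_le_one_right (h.nonneg i) ?_
  have h1 := sum_sq_transpose_mul_le_one h.left_orthonormal hU' i
  have h2 := sum_sq_transpose_mul_le_one h.right_orthonormal hV' i
  have h3 : ∑ a, (U.transpose * U') i a * (V.transpose * V') i a
      ≤ ∑ a, ((U.transpose * U') i a ^ 2 / 2 + (V.transpose * V') i a ^ 2 / 2) :=
    Finset.sum_le_sum fun a _ => by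
      nlinarith [sq_nonneg ((U.transpose * U') i a - (V.transpose * V') i a)]
  rw [Finset.sum_add_distrib, ← Finset.sum_div, ← Finset.sum_div] at h3
  linarith

end SVD

/-- The compact singular value decomposition, built from an eigenbasis of `MᵀM`. -/
lemma exists_isSVD_sum_eq_nuclearNorm {m n : ℕ} (M : Matrix (Fin m) (Fin n) ℝ) :
    ∃ (p : ℕ) (U : Matrix (Fin m) (Fin p) ℝ) (s : Fin p → ℝ) (V : Matrix (Fin n) (Fin p) ℝ),
      IsSVD M U s V ∧ ∑ i, s i = nuclearNorm M := by
  set T := Matrix.toEuclideanLin M with hT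
  set p := Module.finrank ℝ (LinearMap.range T) with hp
  have hdim : Module.finrank ℝ (EuclideanSpace ℝ (Fin n)) = n := by simp
  have hpn : p ≤ n := by simpa using T.finrank_range_le
  have hpm : p ≤ m := by simpa using Submodule.finrank_le (LinearMap.range T)
  set b := T.isSymmetric_adjoint_comp_self.eigenvectorBasis hdim with hb
  have hinner : ∀ i j, inner ℝ (T (b i)) (T (b j))
      = if i = j then T.singularValues i ^ 2 else 0 := by
    intro i j
    rw [← LinearMap.adjoint_inner_right, ← LinearMap.comp_apply,
      T.isSymmetric_adjoint_comp_self.apply_eigenvectorBasis hdim, ← hb, inner_smul_right,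
      orthonormal_iff_ite.1 b.orthonormal, T.sq_singularValues_fin hdim]
    split_ifs with hij
    · simp [hij]
    · simp
  have hzero : ∀ i : Fin n, p ≤ i → T (b i) = 0 := by
    intro i hi
    have := hinner i i
    rwa [if_pos rfl, T.singularValues_eq_zero_iff_le_finrank_range.2 hi, zero_pow two_ne_zero,
      inner_self_eq_zero] at this
  have hpos : ∀ i : Fin p, 0 < T.singularValues i := fun i =>
    T.singularValues_pos_iff_lt_finrank_range.2 i.2
  refine ⟨p, Matrix.of fun a i => (T.singularValues i)⁻¹ * T (b (Fin.castLE hpn i)) a,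
    fun i => T.singularValues i, Matrix.of fun a i => b (Fin.castLE hpn i) a,
    ⟨?_, ?_, fun i => (hpos i).le, ?_⟩, ?_⟩
  · ext i j
    have := hinner (Fin.castLE hpn i) (Fin.castLE hpn j)
    simp only [PiLp.inner_apply, RCLike.inner_apply, conj_trivial, Fin.val_castLE,
      Fin.castLE_inj] at this
    simp only [Matrix.mul_apply, Matrix.transpose_apply, Matrix.of_apply, Matrix.one_apply]
    calc _ = (T.singularValues i)⁻¹ * (T.singularValues j)⁻¹
          * ∑ x, T (b (Fin.castLE hpn j)) x * T (b (Fin.castLE hpn i)) x := by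
            rw [Finset.mul_sum]
            exact Finset.sum_congr rfl fun x _ => by ring
      _ = _ := by
        rw [this]
        split_ifs with hij
        · subst hij
          have := (hpos i).ne'
          field_simp
        · simp
  · ext i j
    have := orthonormal_iff_ite.1 b.orthonormal (Fin.castLE hpn i) (Fin.castLE hpn j)
    simp only [PiLp.inner_apply, RCLike.inner_apply, conj_trivial, Fin.castLE_inj] at this
    simp only [Matrix.mul_apply, Matrix.transpose_apply, Matrix.of_apply, Matrix.one_apply]
    rw [← this]
    exact Finset.sum_congr rfl fun x _ => mul_comm _ _
  · ext a c
    have hM : M a c = T (EuclideanSpace.single c 1) a := by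
      simp [hT, Matrix.toLpLin_apply]
    rw [hM, ← b.sum_repr' (EuclideanSpace.single c 1), map_sum]
    rw [Matrix.mul_apply]
    simp only [Matrix.mul_diagonal, Matrix.transpose_apply, Matrix.of_apply, map_smul,
      WithLp.ofLp_sum, Finset.sum_apply, PiLp.smul_apply, smul_eq_mul]
    symm
    refine Fintype.sum_of_injective (Fin.castLE hpn) (Fin.castLE_injective hpn) _ _ ?_ ?_
    · intro i hi
      rw [hzero i]
      · simp
      · by_contra h
        exact hi ⟨⟨i, not_le.1 h⟩, rfl⟩
    · intro i
      have := (hpos i).ne'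
      rw [EuclideanSpace.inner_single_right]
      simp
      field_simp
  · rw [nuclearNorm, ← Finset.sum_range (fun i => T.singularValues i)]
    refine Finset.sum_subset (Finset.range_mono (le_min hpm hpn)) fun i _ hi => ?_
    exact T.singularValues_eq_zero_iff_le_finrank_range.2 (by simpa using hi)

section NuclearNorm
variable {m n : ℕ} (A B : Matrix (Fin m) (Fin n) ℝ)

lemma nuclearNorm_nonneg : 0 ≤ nuclearNorm A :=
  Finset.sum_nonneg fun _ _ => LinearMap.singularValues_nonneg _ _

lemma frobeniusInner_self : frobeniusInner A A = frobeniusNorm A ^ 2 := by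
  rw [frobeniusNorm_sq]
  simp only [frobeniusInner, sq]

/-- A matrix sign is a partial isometry, and its rank is at most `min m n`. -/
lemma IsMatrixSign.frobeniusNorm_sq_le {A O : Matrix (Fin m) (Fin n) ℝ} (h : IsMatrixSign A O) :
    frobeniusNorm O ^ 2 ≤ (min m n : ℕ) := by
  obtain ⟨p, U, s, V, h, rfl⟩ := h
  rw [← frobeniusInner_self, frobeniusInner_mul_transpose_self h.1 h.2]
  exact_mod_cast le_min (card_le_of_transpose_mul_self_eq_one h.1)
    (card_le_of_transpose_mul_self_eq_one h.2)

lemma IsMatrixSign.frobeniusNorm_le {A O : Matrix (Fin m) (Fin n) ℝ} (h : IsMatrixSign A O) :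
    frobeniusNorm O ≤ √((min m n : ℕ) : ℝ) :=
  Real.le_sqrt_of_sq_le h.frobeniusNorm_sq_le

/-- Every matrix sign of `A` maximizes the pairing with `A` among all matrix signs. -/
lemma IsMatrixSign.frobeniusInner_le {A B O P : Matrix (Fin m) (Fin n) ℝ} (hO : IsMatrixSign A O)
    (hP : IsMatrixSign B P) : frobeniusInner A P ≤ frobeniusInner A O := by
  obtain ⟨p, U, s, V, h, rfl⟩ := hO
  obtain ⟨q, U', s', V', h', rfl⟩ := hP
  rw [h.frobeniusInner_sign]
  exact h.frobeniusInner_mul_transpose_le h'.1 h'.2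

lemma exists_isMatrixSign_frobeniusInner_eq_nuclearNorm :
    ∃ O, IsMatrixSign A O ∧ frobeniusInner A O = nuclearNorm A := by
  obtain ⟨p, U, s, V, h, hs⟩ := exists_isSVD_sum_eq_nuclearNorm A
  exact ⟨_, ⟨p, U, s, V, h, rfl⟩, h.frobeniusInner_sign.trans hs⟩

lemma frobeniusNorm_le_nuclearNorm : frobeniusNorm A ≤ nuclearNorm A := by
  obtain ⟨p, U, s, V, h, hs⟩ := exists_isSVD_sum_eq_nuclearNorm A
  refine le_of_sq_le_sq ?_ (nuclearNorm_nonneg A)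
  rw [← frobeniusInner_self, h.frobeniusInner_self, ← hs]
  exact Finset.sum_sq_le_sq_sum_of_nonneg fun i _ => h.nonneg i

lemma nuclearNorm_le_add :
    nuclearNorm A ≤ nuclearNorm B + √((min m n : ℕ) : ℝ) * frobeniusNorm (A - B) := by
  obtain ⟨O, hO, hA⟩ := exists_isMatrixSign_frobeniusInner_eq_nuclearNorm A
  obtain ⟨P, hP, hB⟩ := exists_isMatrixSign_frobeniusInner_eq_nuclearNorm B
  have h1 := hP.frobeniusInner_le hO
  have h2 := frobeniusInner_le (A - B) O
  have h3 := mul_le_mul_of_nonneg_left hO.frobeniusNorm_le (frobeniusNorm_nonneg (A - B))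
  rw [frobeniusInner_sub_left] at h2
  linarith

/-- A step along a matrix sign of an approximate gradient `A'` decreases the linear model of the
true gradient `A` by almost its nuclear norm. -/
lemma IsMatrixSign.nuclearNorm_sub_le_frobeniusInner {A A' O : Matrix (Fin m) (Fin n) ℝ}
    (hO : IsMatrixSign A' O) :
    nuclearNorm A - 2 * √((min m n : ℕ) : ℝ) * frobeniusNorm (A' - A) ≤ frobeniusInner A O := by
  obtain ⟨P, hP, hA⟩ := exists_isMatrixSign_frobeniusInner_eq_nuclearNorm A
  have h1 := hO.frobeniusInner_le hP
  have h2 := _root_.frobeniusInner_le (A' - A) (O - P)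
  have h3 : frobeniusNorm (O - P) ≤ 2 * √((min m n : ℕ) : ℝ) := by
    linarith [frobeniusNorm_sub_le_add O P, hO.frobeniusNorm_le, hP.frobeniusNorm_le]
  have h4 := mul_le_mul_of_nonneg_left h3 (frobeniusNorm_nonneg (A' - A))
  rw [frobeniusInner_sub_left, frobeniusInner_sub_right, frobeniusInner_sub_right] at h2
  linarith

lemma nuclearNorm_le : nuclearNorm A ≤ √((min m n : ℕ) : ℝ) * frobeniusNorm A := by
  obtain ⟨O, hO, hA⟩ := exists_isMatrixSign_frobeniusInner_eq_nuclearNorm A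
  have h2 := frobeniusInner_le A O
  have h3 := mul_le_mul_of_nonneg_left hO.frobeniusNorm_le (frobeniusNorm_nonneg A)
  linarith

lemma continuous_frobeniusNorm :
    Continuous (frobeniusNorm : Matrix (Fin m) (Fin n) ℝ → ℝ) := by
  unfold frobeniusNorm
  fun_prop

lemma continuous_nuclearNorm : Continuous (nuclearNorm : Matrix (Fin m) (Fin n) ℝ → ℝ) := by
  rw [continuous_iff_continuousAt]
  intro A
  rw [ContinuousAt, tendsto_iff_dist_tendsto_zero]
  have hlim : Filter.Tendsto (fun B => √((min m n : ℕ) : ℝ) * frobeniusNorm (B - A)) (nhds A)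
      (nhds 0) := by
    have h : Continuous fun B => √((min m n : ℕ) : ℝ) * frobeniusNorm (B - A) :=
      continuous_const.mul (continuous_frobeniusNorm.comp (continuous_id.sub continuous_const))
    have := h.tendsto A
    simpa [frobeniusNorm] using this
  refine squeeze_zero (fun _ => dist_nonneg) (fun B => ?_) hlim
  rw [Real.dist_eq, abs_le]
  have h1 := nuclearNorm_le_add A B
  have h2 := nuclearNorm_le_add B A
  rw [frobeniusNorm_sub_comm] at h1
  constructor <;> linarith

end NuclearNorm

/-! ### Decoupling the mini-batch from the iterate -/

/-- Conditionally on the signal `g`, the clipped samples are i.i.d., so that their average deviates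
from its conditional mean by the variance of one sample divided by `N`. Independence turns the
conditioning into an iterated integral. -/
lemma lintegral_sq_average_hardClip_sub_le {Ω : Type*} [MeasurableSpace Ω] {μ : Measure Ω}
    [IsProbabilityMeasure μ] {N : ℕ} (hN : 0 < N) {g : Ω → ℝ} {ξ : Fin N → Ω → ℝ} {ν : Measure ℝ}
    [SFinite ν] {τ v : ℝ} (hg : Measurable g) (hξ : ∀ l, Measurable (ξ l))
    (hgξ : IndepFun g (fun ω l => ξ l ω) μ)
    (hind : Pairwise fun l l' => IndepFun (ξ l) (ξ l') μ)
    (hlaw : ∀ l, μ.map (ξ l) = ν) (hgτ : ∀ᵐ ω ∂μ, |g ω| ≤ τ) (hτ : 0 ≤ τ) (hv : 0 ≤ v)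
    (hvar : ∀ a, |a| ≤ τ → ∫⁻ x, ENNReal.ofReal ((hardClip τ (a + x) - a) ^ 2) ∂ν
      ≤ ENNReal.ofReal v) :
    ∫⁻ ω, ENNReal.ofReal (((N : ℝ)⁻¹ * ∑ l, hardClip τ (g ω + ξ l ω)
      - ∫ x, hardClip τ (g ω + x) ∂ν) ^ 2) ∂μ ≤ ENNReal.ofReal (v / N) := by
  have hclip := measurable_hardClip τ
  have hξ' : Measurable fun ω l => ξ l ω := measurable_pi_lambda _ hξ
  have hmean : Measurable fun a => ∫ x, hardClip τ (a + x) ∂ν :=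
    (StronglyMeasurable.integral_prod_right' (f := fun z : ℝ × ℝ => hardClip τ (z.1 + z.2))
      (by fun_prop : Measurable _).stronglyMeasurable).measurable
  have hF : Measurable fun z : ℝ × (Fin N → ℝ) =>
      ENNReal.ofReal (((N : ℝ)⁻¹ * ∑ l, hardClip τ (z.1 + z.2 l)
        - ∫ x, hardClip τ (z.1 + x) ∂ν) ^ 2) := by
    have : Measurable fun z : ℝ × (Fin N → ℝ) => ∫ x, hardClip τ (z.1 + x) ∂ν :=
      hmean.comp measurable_fst
    fun_prop
  have hprod := (indepFun_iff_map_prod_eq_prod_map_map hg.aemeasurable hξ'.aemeasurable).1 hgξ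
  rw [← lintegral_map (f := fun z : ℝ × (Fin N → ℝ) =>
      ENNReal.ofReal (((N : ℝ)⁻¹ * ∑ l, hardClip τ (z.1 + z.2 l)
        - ∫ x, hardClip τ (z.1 + x) ∂ν) ^ 2)) (g := fun ω => (g ω, fun l => ξ l ω)) hF
      (hg.prodMk hξ'), hprod, lintegral_prod _ hF.aemeasurable]
  have hgae : ∀ᵐ a ∂μ.map g, |a| ≤ τ :=
    (ae_map_iff hg.aemeasurable (measurableSet_le measurable_id.norm measurable_const)).2 hgτ
  have := Measure.isProbabilityMeasure_map (μ := μ) hg.aemeasurable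
  calc _ ≤ ∫⁻ _, ENNReal.ofReal (v / N) ∂μ.map g := by
        refine lintegral_mono_ae ?_
        filter_upwards [hgae] with a ha
        rw [lintegral_map (by fun_prop) hξ']
        have hY : ∀ l, MemLp (fun ω => hardClip τ (a + ξ l ω)) 2 μ := fun l =>
          MemLp.of_bound (by fun_prop : Measurable _).aestronglyMeasurable τ
            (Filter.Eventually.of_forall fun _ => abs_hardClip_le hτ _)
        refine lintegral_sq_average_sub_le (Y := fun l ω => hardClip τ (a + ξ l ω)) hN hY
          (fun l l' hl => (hind hl).comp (φ := fun x => hardClip τ (a + x))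
            (ψ := fun x => hardClip τ (a + x)) (by fun_prop) (by fun_prop)) (fun l => ?_)
          (fun l => variance_le_of_lintegral_sq_sub_le (hY l) (g := a) hv ?_)
        · rw [← hlaw l, integral_map (hξ l).aemeasurable
            (by fun_prop : Measurable _).aestronglyMeasurable]
        · refine le_trans (le_of_eq ?_) (hvar a ha)
          rw [← hlaw l, lintegral_map (by fun_prop) (hξ l)]
    _ = ENNReal.ofReal (v / N) := by simp

lemma integrable_and_integral_le_sqrt {Ω : Type*} [MeasurableSpace Ω] {μ : Measure Ω}
    [IsProbabilityMeasure μ] {Z : Ω → ℝ} (hZ : Measurable Z) {K : ℝ} (hK : 0 ≤ K)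
    (h : ∫⁻ ω, ENNReal.ofReal (Z ω ^ 2) ∂μ ≤ ENNReal.ofReal K) :
    Integrable Z μ ∧ ∫ ω, Z ω ∂μ ≤ √K := by
  have hsq : Integrable (fun ω => Z ω ^ 2) μ := by
    refine ⟨(hZ.pow_const 2).aestronglyMeasurable, ?_⟩
    rw [hasFiniteIntegral_iff_ofReal (Filter.Eventually.of_forall fun _ => sq_nonneg _)]
    exact h.trans_lt ENNReal.ofReal_lt_top
  have hL2 : MemLp Z 2 μ := (memLp_two_iff_integrable_sq hZ.aestronglyMeasurable).2 hsq
  refine ⟨hL2.integrable one_le_two, Real.le_sqrt_of_sq_le ?_⟩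
  have hvar := variance_nonneg Z μ
  rw [variance_eq_sub hL2] at hvar
  have hle : ∫ ω, Z ω ^ 2 ∂μ ≤ K := by
    rw [← ENNReal.ofReal_le_ofReal_iff hK, ofReal_integral_eq_lintegral_ofReal hsq
      (Filter.Eventually.of_forall fun _ => sq_nonneg _)]
    exact h
  have : ∫ ω, (Z ^ 2) ω ∂μ = ∫ ω, Z ω ^ 2 ∂μ := rfl
  linarith

/-! ### Gradients -/

lemma measurable_matrixGradient {m n : ℕ} (f : Matrix (Fin m) (Fin n) ℝ → ℝ) :
    Measurable (matrixGradient f) :=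
  measurable_pi_lambda _ fun i => measurable_pi_lambda _ fun j =>
    measurable_fderiv_apply_const ℝ (E := Fin m → Fin n → ℝ) f (Matrix.single i j 1)

lemma matrixGradient_eq_zero_of_forall_le {m n : ℕ} {f : Matrix (Fin m) (Fin n) ℝ → ℝ}
    {X : Matrix (Fin m) (Fin n) ℝ} (h : ∀ Y, f X ≤ f Y) : matrixGradient f X = 0 := by
  have hX : fderiv ℝ f X = 0 := IsLocalMin.fderiv_eq_zero (E := Fin m → Fin n → ℝ)
    (Filter.Eventually.of_forall h)
  ext i j
  simp [matrixGradient, hX]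

lemma measurable_of_continuous_matrix {m n : ℕ} {F : Matrix (Fin m) (Fin n) ℝ → ℝ}
    (hF : Continuous F) : Measurable F :=
  Continuous.measurable (α := Fin m → Fin n → ℝ) hF

lemma measurable_nuclearNorm {m n : ℕ} :
    Measurable (nuclearNorm : Matrix (Fin m) (Fin n) ℝ → ℝ) :=
  measurable_of_continuous_matrix continuous_nuclearNorm

lemma measurable_frobeniusNorm {m n : ℕ} :
    Measurable (frobeniusNorm : Matrix (Fin m) (Fin n) ℝ → ℝ) :=
  measurable_of_continuous_matrix continuous_frobeniusNorm

/-- The descent inequality for one step along the matrix sign of a gradient estimate `A`. -/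
lemma IsFrobeniusSmooth.step_le {m n : ℕ} {L η : ℝ} {f : Matrix (Fin m) (Fin n) ℝ → ℝ}
    (hf : IsFrobeniusSmooth L f) (hL : 0 ≤ L) (hη : 0 ≤ η) {X A O : Matrix (Fin m) (Fin n) ℝ}
    (hO : IsMatrixSign A O) :
    f (X - η • O) ≤ f X - η * (nuclearNorm (matrixGradient f X)
      - 2 * √((min m n : ℕ) : ℝ) * frobeniusNorm (A - matrixGradient f X))
      + L / 2 * η ^ 2 * (min m n : ℕ) := by
  have h := hf.le_quadratic X (X - η • O)
  have e1 : ∑ i, ∑ j, matrixGradient f X i j * ((X - η • O) i j - X i j)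
      = -(η * frobeniusInner (matrixGradient f X) O) := by
    simp only [frobeniusInner, Finset.mul_sum, ← Finset.sum_neg_distrib]
    refine Finset.sum_congr rfl fun i _ => Finset.sum_congr rfl fun j _ => ?_
    simp
    ring
  have e2 : ∑ i, ∑ j, ((X - η • O) i j - X i j) ^ 2 = η ^ 2 * frobeniusNorm O ^ 2 := by
    simp only [frobeniusNorm_sq, Finset.mul_sum]
    refine Finset.sum_congr rfl fun i _ => Finset.sum_congr rfl fun j _ => ?_
    simp
    ring
  rw [e1, e2] at h
  have h1 := mul_le_mul_of_nonneg_left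
    (hO.nuclearNorm_sub_le_frobeniusInner (A := matrixGradient f X)) hη
  have h2 := mul_le_mul_of_nonneg_left hO.frobeniusNorm_sq_le
    (show 0 ≤ L / 2 * η ^ 2 by positivity)
  linarith

lemma frobeniusNorm_le_mul_of_abs_le {m n : ℕ} {A B : Matrix (Fin m) (Fin n) ℝ} {κ : ℝ}
    (hκ : 0 ≤ κ) (h : ∀ i j, |A i j| ≤ κ * |B i j|) : frobeniusNorm A ≤ κ * frobeniusNorm B := by
  refine le_of_sq_le_sq ?_ (mul_nonneg hκ (frobeniusNorm_nonneg B))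
  rw [mul_pow, frobeniusNorm_sq, frobeniusNorm_sq, Finset.mul_sum]
  refine Finset.sum_le_sum fun i _ => ?_
  rw [Finset.mul_sum]
  refine Finset.sum_le_sum fun j _ => ?_
  have := pow_le_pow_left₀ (abs_nonneg _) (h i j) 2
  rwa [mul_pow, sq_abs, sq_abs] at this

/-! ### The expected error of the gradient estimate -/

/-- The entrywise expectation `E C_τ(A + Ξ)` of the clipped noisy matrix. -/
noncomputable def clippedMean {m n : ℕ} {Ω : Type*} [MeasurableSpace Ω] (μ : Measure Ω) (τ : ℝ)
    (Ξ : Ω → Matrix (Fin m) (Fin n) ℝ) (A : Matrix (Fin m) (Fin n) ℝ) :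
    Matrix (Fin m) (Fin n) ℝ :=
  Matrix.of fun i j => ∫ ω, hardClip τ (A i j + Ξ ω i j) ∂μ

lemma measurable_matrix_entry {m n : ℕ} (i : Fin m) (j : Fin n) :
    Measurable fun A : Matrix (Fin m) (Fin n) ℝ => A i j :=
  (measurable_pi_apply j).comp (measurable_pi_apply (X := fun _ : Fin m => Fin n → ℝ) i)

lemma measurable_of_measurable_entry {m n : ℕ} {Ω : Type*} [MeasurableSpace Ω]
    {F : Ω → Matrix (Fin m) (Fin n) ℝ} (hF : ∀ i j, Measurable fun ω => F ω i j) : Measurable F :=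
  measurable_pi_lambda _ fun i => measurable_pi_lambda _ fun j => hF i j

lemma lintegral_sq_frobeniusNorm_le {m n : ℕ} {Ω : Type*} [MeasurableSpace Ω] {μ : Measure Ω}
    {F : Ω → Matrix (Fin m) (Fin n) ℝ} (hF : ∀ i j, Measurable fun ω => F ω i j) {w : ℝ}
    (h : ∀ i j, ∫⁻ ω, ENNReal.ofReal (F ω i j ^ 2) ∂μ ≤ ENNReal.ofReal w) :
    ∫⁻ ω, ENNReal.ofReal (frobeniusNorm (F ω) ^ 2) ∂μ ≤ ENNReal.ofReal (m * n * w) := by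
  have hsum : ∀ A : Matrix (Fin m) (Fin n) ℝ, ENNReal.ofReal (frobeniusNorm A ^ 2)
      = ∑ i, ∑ j, ENNReal.ofReal (A i j ^ 2) := by
    intro A
    rw [frobeniusNorm_sq,
      ENNReal.ofReal_sum_of_nonneg (f := fun i => ∑ j, A i j ^ 2)
        fun _ _ => Finset.sum_nonneg fun _ _ => sq_nonneg _]
    exact Finset.sum_congr rfl fun i _ =>
      ENNReal.ofReal_sum_of_nonneg (f := fun j => A i j ^ 2) fun _ _ => sq_nonneg _
  have hm : ∀ i j, Measurable fun ω => ENNReal.ofReal (F ω i j ^ 2) := fun i j =>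
    ((hF i j).pow_const 2).ennreal_ofReal
  simp only [hsum]
  rw [lintegral_finsetSum _ fun i _ => Finset.measurable_sum _ fun j _ => hm i j]
  calc _ = ∑ i, ∑ j, ∫⁻ ω, ENNReal.ofReal (F ω i j ^ 2) ∂μ :=
        Finset.sum_congr rfl fun i _ => lintegral_finsetSum _ fun j _ => hm i j
    _ ≤ ∑ _i : Fin m, ∑ _j : Fin n, ENNReal.ofReal w :=
        Finset.sum_le_sum fun i _ => Finset.sum_le_sum fun j _ => h i j
    _ = ENNReal.ofReal (m * n * w) := by
        rw [ENNReal.ofReal_mul (by positivity), ENNReal.ofReal_mul (by positivity)]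
        simp [mul_assoc]

lemma measurable_clippedMean {m n : ℕ} {Ω : Type*} [MeasurableSpace Ω] (μ : Measure Ω) [SFinite μ]
    (τ : ℝ) {Ξ : Ω → Matrix (Fin m) (Fin n) ℝ} (hΞ : Measurable Ξ) :
    Measurable (clippedMean μ τ Ξ) := by
  refine measurable_pi_lambda _ fun i => measurable_pi_lambda _ fun j => ?_
  have hclip := measurable_hardClip τ
  have h1 := (measurable_matrix_entry i j).comp hΞ
  have h2 := measurable_matrix_entry i j
  exact (StronglyMeasurable.integral_prod_right' (ν := μ)
    (f := fun z : Matrix (Fin m) (Fin n) ℝ × Ω => hardClip τ (z.1 i j + Ξ z.2 i j))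
    (hclip.comp
      ((h2.comp measurable_fst).add (h1.comp measurable_snd))).stronglyMeasurable).measurable

lemma clippedBatch_apply {m n N : ℕ} (τ : ℝ) (G : Matrix (Fin m) (Fin n) ℝ)
    (Ξ : Fin N → Matrix (Fin m) (Fin n) ℝ) (i : Fin m) (j : Fin n) :
    clippedBatch τ G Ξ i j = (N : ℝ)⁻¹ * ∑ l, hardClip τ (G i j + Ξ l i j) := by
  simp [clippedBatch, Matrix.sum_apply]

section Noise
variable {m n N T k : ℕ} {Ω : Type*} [MeasurableSpace Ω] {μ : Measure Ω}
  {B α σ γ τ r v : ℝ} {X : ℕ → Ω → Matrix (Fin m) (Fin n) ℝ}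
  {Ξ : ℕ → Fin N → Ω → Matrix (Fin m) (Fin n) ℝ}
  {G : Matrix (Fin m) (Fin n) ℝ → Matrix (Fin m) (Fin n) ℝ}

lemma isProbabilityMeasure_gaussianCauchyMixture {s c : ℝ} (hα : 0 ≤ α) (hα' : α ≤ 1) :
    IsProbabilityMeasure (gaussianCauchyMixture α s c) := by
  constructor
  simp only [gaussianCauchyMixture, Measure.add_apply, Measure.smul_apply, measure_univ,
    smul_eq_mul, mul_one]
  rw [← ENNReal.ofReal_add (by linarith) hα]
  simp

/-- The clipping bias is relative: a matrix with entries bounded by `B` is reproduced in the mean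
up to the factor `1 / (4 √r)`. -/
lemma IsNoiseModel.frobeniusNorm_clippedMean_sub_le (h : IsNoiseModel μ α σ γ T X Ξ) (hk : k < T)
    (l : Fin N) (hα : 0 ≤ α) (hα' : α ≤ 1) (hr : 1 ≤ r) (hτ0 : 0 ≤ τ)
    (hτ : B + max (σ * √(2 * Real.log (16 * √r))) (16 * α * γ * √r / Real.pi) ≤ τ)
    {A : Matrix (Fin m) (Fin n) ℝ} (hA : ∀ i j, |A i j| ≤ B) :
    frobeniusNorm (clippedMean μ τ (Ξ k l) A - A) ≤ 1 / (4 * √r) * frobeniusNorm A := by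
  refine frobeniusNorm_le_mul_of_abs_le (by positivity) fun i j => ?_
  obtain ⟨s, c, hs, hsσ, hc, hcγ, hlaw⟩ := h.entry_law k hk i j
  have := isProbabilityMeasure_gaussianCauchyMixture (s := s) (c := c) hα hα'
  have hclip := measurable_hardClip τ
  have hΞ : Measurable fun ω => Ξ k l ω i j :=
    (measurable_matrix_entry i j).comp (h.measurable k hk l)
  have hint : ∫ ω, hardClip τ (A i j + Ξ k l ω i j) ∂μ
      = ∫ x, hardClip τ (A i j + x) ∂gaussianCauchyMixture α s c := by
    rw [← hlaw l, integral_map hΞ.aemeasurable (by fun_prop : Measurable _).aestronglyMeasurable]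
  rw [Matrix.sub_apply, clippedMean, Matrix.of_apply, hint]
  refine (abs_integral_hardClip_add_sub_le (map_neg_gaussianCauchyMixture α s c) hτ0
    (hA i j)).trans ?_
  gcongr
  rw [← ENNReal.ofReal_le_ofReal_iff (by positivity), ofReal_measureReal]
  exact gaussianCauchyMixture_lt_abs_le hα hα' hs hsσ hc hcγ hr (by linarith)

lemma IsNoiseModel.lintegral_sq_clippedBatch_sub_clippedMean_le [IsProbabilityMeasure μ]
    (h : IsNoiseModel μ α σ γ T X Ξ)
    (hk : k < T) (hN : 0 < N) (l₀ : Fin N) (hα : 0 ≤ α) (hα' : α ≤ 1) (hγ : 0 < γ) (hτ0 : 0 ≤ τ)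
    (hX : Measurable (X k)) (hG : Measurable G)
    (hGτ : ∀ᵐ ω ∂μ, ∀ i j, |G (X k ω) i j| ≤ τ)
    (hv : v = (1 - α) * σ ^ 2 + 4 * α * γ * τ / Real.pi) (i : Fin m) (j : Fin n) :
    ∫⁻ ω, ENNReal.ofReal ((clippedBatch τ (G (X k ω)) (fun l => Ξ k l ω)
      - clippedMean μ τ (Ξ k l₀) (G (X k ω))) i j ^ 2) ∂μ ≤ ENNReal.ofReal (v / N) := by
  have hclip := measurable_hardClip τ
  have hpi := Real.pi_pos
  have hα1 : 0 ≤ 1 - α := by linarith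
  have hv0 : 0 ≤ v := by rw [hv]; positivity
  have hGX : Measurable fun ω => G (X k ω) i j := (measurable_matrix_entry i j).comp (hG.comp hX)
  have hΞ : ∀ l, Measurable fun ω => Ξ k l ω i j := fun l =>
    (measurable_matrix_entry i j).comp (h.measurable k hk l)
  obtain ⟨s, c, hs, hsσ, hc, hcγ, hlaw⟩ := h.entry_law k hk i j
  have := isProbabilityMeasure_gaussianCauchyMixture (s := s) (c := c) hα hα'
  have hcm : ∀ a, ∫ ω, hardClip τ (a + Ξ k l₀ ω i j) ∂μ
      = ∫ x, hardClip τ (a + x) ∂gaussianCauchyMixture α s c := by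
    intro a
    rw [← hlaw l₀, integral_map (hΞ l₀).aemeasurable
      (by fun_prop : Measurable _).aestronglyMeasurable]
  have hpick : Measurable fun (Z : Fin N → Matrix (Fin m) (Fin n) ℝ) (l : Fin N) => Z l i j :=
    measurable_pi_lambda _ fun l => (measurable_matrix_entry i j).comp (measurable_pi_apply l)
  have hindg : IndepFun (fun ω => G (X k ω) i j) (fun ω l => Ξ k l ω i j) μ :=
    (h.indep_iterate k hk).comp ((measurable_matrix_entry i j).comp hG) hpick
  have hind : Pairwise fun l l' => IndepFun (fun ω => Ξ k l ω i j) (fun ω => Ξ k l' ω i j) μ := by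
    intro l l' hl
    have hne : ((⟨k, hk⟩, l) : Fin T × Fin N) ≠ (⟨k, hk⟩, l') := by simpa using hl
    exact (h.iIndep.indepFun hne).comp (measurable_matrix_entry i j) (measurable_matrix_entry i j)
  have hmain := lintegral_sq_average_hardClip_sub_le (ξ := fun l ω => Ξ k l ω i j) hN hGX hΞ hindg
    hind hlaw (hGτ.mono fun ω hω => hω i j) hτ0 hv0 (fun a ha => by
      rw [hv]
      exact lintegral_sq_hardClip_add_sub_gaussianCauchyMixture_le hα hα' hs hsσ hc hcγ ha)
  refine le_trans (le_of_eq (lintegral_congr fun ω => ?_)) hmain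
  rw [Matrix.sub_apply, clippedBatch_apply, clippedMean, Matrix.of_apply, hcm]

/-- The fluctuation of the mini-batch around its conditional mean, summed over all entries. -/
lemma IsNoiseModel.integrable_and_integral_frobeniusNorm_le [IsProbabilityMeasure μ]
    (h : IsNoiseModel μ α σ γ T X Ξ)
    (hk : k < T) (hN : 0 < N) (l₀ : Fin N) (hα : 0 ≤ α) (hα' : α ≤ 1) (hγ : 0 < γ) (hτ0 : 0 ≤ τ)
    (hX : Measurable (X k)) (hG : Measurable G)
    (hGτ : ∀ᵐ ω ∂μ, ∀ i j, |G (X k ω) i j| ≤ τ)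
    (hv : v = (1 - α) * σ ^ 2 + 4 * α * γ * τ / Real.pi) :
    Integrable (fun ω => frobeniusNorm (clippedBatch τ (G (X k ω)) (fun l => Ξ k l ω)
        - clippedMean μ τ (Ξ k l₀) (G (X k ω)))) μ ∧
      ∫ ω, frobeniusNorm (clippedBatch τ (G (X k ω)) (fun l => Ξ k l ω)
        - clippedMean μ τ (Ξ k l₀) (G (X k ω))) ∂μ ≤ √(m * n * (v / N)) := by
  have hclip := measurable_hardClip τ
  have hpi := Real.pi_pos
  have hα1 : 0 ≤ 1 - α := by linarith
  have hv0 : 0 ≤ v := by rw [hv]; positivity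
  have hGX : ∀ i j, Measurable fun ω => G (X k ω) i j := fun i j =>
    (measurable_matrix_entry i j).comp (hG.comp hX)
  have hΞ : ∀ l i j, Measurable fun ω => Ξ k l ω i j := fun l i j =>
    (measurable_matrix_entry i j).comp (h.measurable k hk l)
  have hmean : ∀ i j, Measurable fun ω => clippedMean μ τ (Ξ k l₀) (G (X k ω)) i j := fun i j =>
    (measurable_matrix_entry i j).comp
      ((measurable_clippedMean μ τ (h.measurable k hk l₀)).comp (hG.comp hX))
  have hdiff : ∀ i j, Measurable fun ω => (clippedBatch τ (G (X k ω)) (fun l => Ξ k l ω)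
      - clippedMean μ τ (Ξ k l₀) (G (X k ω))) i j := by
    intro i j
    simp only [Matrix.sub_apply, clippedBatch_apply]
    exact (measurable_const.mul (Finset.measurable_sum _ fun l _ =>
      hclip.comp ((hGX i j).add (hΞ l i j)))).sub (hmean i j)
  have hmeas : Measurable fun ω => clippedBatch τ (G (X k ω)) (fun l => Ξ k l ω)
      - clippedMean μ τ (Ξ k l₀) (G (X k ω)) :=
    measurable_of_measurable_entry hdiff
  have hentry := h.lintegral_sq_clippedBatch_sub_clippedMean_le hk hN l₀ hα hα' hγ hτ0 hX hG hGτ hv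
  refine integrable_and_integral_le_sqrt (measurable_frobeniusNorm.comp hmeas) (by positivity) ?_
  exact lintegral_sq_frobeniusNorm_le hdiff hentry

end Noise

/-! ### The convergence rate -/

section Run
variable {m n N T : ℕ} {Ω : Type*} [MeasurableSpace Ω] {μ : Measure Ω}
  {f : Matrix (Fin m) (Fin n) ℝ → ℝ} {x₀ : Matrix (Fin m) (Fin n) ℝ}
  {L Δ B α σ γ τ η r D v : ℝ} {X : ℕ → Ω → Matrix (Fin m) (Fin n) ℝ}
  {Ξ : ℕ → Fin N → Ω → Matrix (Fin m) (Fin n) ℝ}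

lemma IsAdmissibleRun.integrable_nuclearNorm [IsProbabilityMeasure μ]
    (h : IsAdmissibleRun μ f x₀ B α σ γ τ η T X Ξ) (hB : 0 ≤ B) {k : ℕ} (hk : k < T) :
    Integrable (fun ω => nuclearNorm (matrixGradient f (X k ω))) μ := by
  refine Integrable.of_bound (measurable_nuclearNorm.comp ((measurable_matrixGradient f).comp
    (h.update.measurable k hk.le))).aestronglyMeasurable
    (√((min m n : ℕ) : ℝ) * (B * frobeniusNorm (Matrix.of fun (_ : Fin m) (_ : Fin n) => (1 : ℝ))))
    ?_
  filter_upwards [h.gradient_bounded k hk] with ω hω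
  rw [Real.norm_of_nonneg (nuclearNorm_nonneg _)]
  refine (nuclearNorm_le _).trans ?_
  gcongr
  exact frobeniusNorm_le_mul_of_abs_le hB (by simpa using hω)

/-- One step of the run: half of the nuclear norm of the gradient survives the clipping bias. -/
lemma IsAdmissibleRun.ae_step_le (h : IsAdmissibleRun μ f x₀ B α σ γ τ η T X Ξ)
    (hf : IsFrobeniusSmooth L f) (hL : 0 ≤ L) (hη : 0 ≤ η) (l₀ : Fin N)
    (hα : 0 ≤ α) (hα' : α ≤ 1) (hr : r = ((min m n : ℕ) : ℝ)) (hr1 : 1 ≤ r) (hτ0 : 0 ≤ τ)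
    (hτ : B + max (σ * √(2 * Real.log (16 * √r))) (16 * α * γ * √r / Real.pi) ≤ τ)
    {k : ℕ} (hk : k < T) :
    ∀ᵐ ω ∂μ, η / 2 * nuclearNorm (matrixGradient f (X k ω))
      ≤ f (X k ω) - f (X (k + 1) ω)
        + 2 * η * √r * frobeniusNorm
          (clippedBatch τ (matrixGradient f (X k ω)) (fun l => Ξ k l ω)
            - clippedMean μ τ (Ξ k l₀) (matrixGradient f (X k ω)))
        + L / 2 * η ^ 2 * r := by
  filter_upwards [h.gradient_bounded k hk] with ω hω
  obtain ⟨O, hO, hX⟩ := h.update.step k hk ω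
  set A := matrixGradient f (X k ω)
  set C := clippedBatch τ A (fun l => Ξ k l ω)
  set H := clippedMean μ τ (Ξ k l₀) A
  have hstep := hf.step_le hL hη (X := X k ω) hO
  rw [← hX, ← hr] at hstep
  have hbias := h.noise.frobeniusNorm_clippedMean_sub_le hk l₀ hα hα' hr1 hτ0 hτ hω
  have htri : frobeniusNorm (C - A) ≤ frobeniusNorm (C - H) + frobeniusNorm (H - A) := by
    have := frobeniusNorm_add_le (C - H) (H - A)
    rwa [sub_add_sub_cancel] at this
  have hsr : 0 < √r := Real.sqrt_pos.2 (by linarith)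
  have hnuc : √r * frobeniusNorm (H - A) ≤ nuclearNorm A / 4 := by
    calc √r * frobeniusNorm (H - A) ≤ √r * (1 / (4 * √r) * nuclearNorm A) := by
          gcongr
          refine hbias.trans ?_
          gcongr
          exact frobeniusNorm_le_nuclearNorm A
      _ = nuclearNorm A / 4 := by field_simp
  have h1 := mul_le_mul_of_nonneg_left htri (show 0 ≤ 2 * η * √r by positivity)
  have h2 := mul_le_mul_of_nonneg_left hnuc (show 0 ≤ 2 * η by positivity)
  change f (X (k + 1) ω) ≤ f (X k ω) - η * (nuclearNorm A - 2 * √r * frobeniusNorm (C - A))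
    + L / 2 * η ^ 2 * r at hstep
  linarith

/-- Telescoping the descent inequality along almost every path before taking expectations. -/
lemma IsAdmissibleRun.mul_averageNuclear_le [IsProbabilityMeasure μ]
    (h : IsAdmissibleRun μ f x₀ B α σ γ τ η T X Ξ)
    (hf : IsFrobeniusSmooth L f) (hL : 0 ≤ L) (hbdd : BddBelow (Set.range f))
    (hΔ : Δ = f x₀ - ⨅ X, f X) (hη : 0 ≤ η) (hT : 0 < T) (hN : 0 < N)
    (hα : 0 ≤ α) (hα' : α ≤ 1) (hσ : 0 ≤ σ) (hγ : 0 < γ) (hr : r = ((min m n : ℕ) : ℝ))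
    (hr1 : 1 ≤ r) (hB : 0 ≤ B)
    (hτ : B + max (σ * √(2 * Real.log (16 * √r))) (16 * α * γ * √r / Real.pi) ≤ τ)
    (hv : v = (1 - α) * σ ^ 2 + 4 * α * γ * τ / Real.pi) :
    η / 2 * (T * averageNuclear μ f T X)
      ≤ Δ + T * (2 * η * √r * √(m * n * (v / N)) + L / 2 * η ^ 2 * r) := by
  have hBτ : B ≤ τ := by
    have : 0 ≤ max (σ * √(2 * Real.log (16 * √r))) (16 * α * γ * √r / Real.pi) :=
      le_max_of_le_left (by positivity)
    linarith
  have hτ0 : 0 ≤ τ := hB.trans hBτ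
  let l₀ : Fin N := ⟨0, hN⟩
  let E : ℕ → Ω → ℝ := fun k ω => frobeniusNorm
    (clippedBatch τ (matrixGradient f (X k ω)) (fun l => Ξ k l ω)
      - clippedMean μ τ (Ξ k l₀) (matrixGradient f (X k ω)))
  have hE : ∀ k < T, Integrable (E k) μ ∧ ∫ ω, E k ω ∂μ ≤ √(m * n * (v / N)) := fun k hk =>
    h.noise.integrable_and_integral_frobeniusNorm_le hk hN l₀ hα hα' hγ hτ0
      (h.update.measurable k hk.le) (measurable_matrixGradient f)
      ((h.gradient_bounded k hk).mono fun ω hω i j => (hω i j).trans hBτ) hv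
  have hpath : ∀ᵐ ω ∂μ, η / 2 * ∑ k ∈ Finset.range T, nuclearNorm (matrixGradient f (X k ω))
      ≤ Δ + 2 * η * √r * ∑ k ∈ Finset.range T, E k ω + T * (L / 2 * η ^ 2 * r) := by
    have hall : ∀ᵐ ω ∂μ, ∀ k ∈ Finset.range T, η / 2 * nuclearNorm (matrixGradient f (X k ω))
        ≤ f (X k ω) - f (X (k + 1) ω) + 2 * η * √r * E k ω + L / 2 * η ^ 2 * r :=
      (Finset.eventually_all _).2 fun k hk =>
        h.ae_step_le hf hL hη l₀ hα hα' hr hr1 hτ0 hτ (Finset.mem_range.1 hk)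
    filter_upwards [hall] with ω hω
    have hsum := Finset.sum_le_sum hω
    rw [← Finset.mul_sum, Finset.sum_add_distrib, Finset.sum_add_distrib,
      Finset.sum_range_sub' (fun k => f (X k ω)), ← Finset.mul_sum, Finset.sum_const,
      Finset.card_range, nsmul_eq_mul, h.update.init] at hsum
    have := ciInf_le hbdd (X T ω)
    linarith
  have hiN : ∀ k ∈ Finset.range T,
      Integrable (fun ω => nuclearNorm (matrixGradient f (X k ω))) μ := fun k hk =>
    h.integrable_nuclearNorm hB (Finset.mem_range.1 hk)
  have hiE : ∀ k ∈ Finset.range T, Integrable (E k) μ := fun k hk =>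
    (hE k (Finset.mem_range.1 hk)).1
  have hiS : Integrable (fun ω => Δ + 2 * η * √r * ∑ k ∈ Finset.range T, E k ω) μ :=
    (integrable_const Δ).add ((integrable_finsetSum _ hiE).const_mul (2 * η * √r))
  have hint := integral_mono_ae ((integrable_finsetSum _ hiN).const_mul (η / 2))
    (hiS.add (integrable_const (T * (L / 2 * η ^ 2 * r)))) hpath
  simp only [Pi.add_apply] at hint
  rw [integral_const_mul, integral_finsetSum _ hiN, integral_add hiS (integrable_const _),
    integral_add (integrable_const Δ) ((integrable_finsetSum _ hiE).const_mul (2 * η * √r)),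
    integral_const_mul, integral_finsetSum _ hiE] at hint
  simp only [integral_const, probReal_univ, one_smul] at hint
  have hEsum : ∑ k ∈ Finset.range T, ∫ ω, E k ω ∂μ ≤ T * √(m * n * (v / N)) := by
    refine (Finset.sum_le_sum fun k hk => (hE k (Finset.mem_range.1 hk)).2).trans_eq ?_
    simp
  have hT' : (T : ℝ) ≠ 0 := by exact_mod_cast hT.ne'
  have h1 := mul_le_mul_of_nonneg_left hEsum (show 0 ≤ 2 * η * √r by positivity)
  rw [averageNuclear, mul_inv_cancel_left₀ hT']
  linarith

/-- Without room for descent the step size vanishes and the run stays at a minimizer. -/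
lemma IsAdmissibleRun.averageNuclear_eq_zero (h : IsAdmissibleRun μ f x₀ B α σ γ τ 0 T X Ξ)
    (hbdd : BddBelow (Set.range f)) (hx₀ : f x₀ - ⨅ X, f X = 0) :
    averageNuclear μ f T X = 0 := by
  have hgrad : matrixGradient f x₀ = 0 := matrixGradient_eq_zero_of_forall_le fun Y => by
    linarith [ciInf_le hbdd Y]
  have hX : ∀ k ≤ T, ∀ ω, X k ω = x₀ := by
    intro k
    induction k with
    | zero => exact fun _ ω => h.update.init ω
    | succ k ih =>
      intro hk ω
      obtain ⟨O, -, hO⟩ := h.update.step k hk ω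
      rw [hO, ih (by omega), zero_smul, sub_zero]
  have hnuc : nuclearNorm (0 : Matrix (Fin m) (Fin n) ℝ) = 0 := by simp [nuclearNorm]
  rw [averageNuclear, Finset.sum_eq_zero, mul_zero]
  intro k hk
  simp [hX k (Finset.mem_range.1 hk).le, hgrad, hnuc]

lemma sqrt_mul_sqrt_card_eq (hm : 0 < m) (hn : 0 < n) (hr : r = ((min m n : ℕ) : ℝ))
    (hD : D = √(((max m n : ℕ) : ℝ) / ((min m n : ℕ) : ℝ))) :
    √r * √((m : ℝ) * n) = D * r ^ (3 / 2 : ℝ) := by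
  have hr0 : 0 < r := by rw [hr]; exact_mod_cast lt_min hm hn
  have hmn : (m : ℝ) * n = ((max m n : ℕ) : ℝ) / r * r ^ 2 := by
    have : m * n = max m n * min m n := (max_mul_min m n).symm
    rw [← Nat.cast_mul, this, Nat.cast_mul, ← hr]
    field_simp
  rw [hmn, Real.sqrt_mul (by positivity), Real.sqrt_sq hr0.le, ← hr] at *
  rw [show (3 / 2 : ℝ) = 1 / 2 + 1 by norm_num, Real.rpow_add hr0, Real.rpow_one,
    ← Real.sqrt_eq_rpow, hD]
  ring

theorem IsAdmissibleRun.averageNuclear_le [IsProbabilityMeasure μ] (hm : 0 < m) (hn : 0 < n)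
    (h : IsAdmissibleRun μ f x₀ B α σ γ τ (√(2 * Δ / (L * r * T))) T X Ξ)
    (hf : IsFrobeniusSmooth L f) (hL : 0 < L) (hbdd : BddBelow (Set.range f))
    (hΔ : Δ = f x₀ - ⨅ X, f X) (hT : 0 < T) (hN : 0 < N) (hB : 0 ≤ B)
    (hα : 0 ≤ α) (hα' : α ≤ 1) (hσ : 0 ≤ σ) (hγ : 0 < γ) (hr : r = ((min m n : ℕ) : ℝ))
    (hD : D = √(((max m n : ℕ) : ℝ) / ((min m n : ℕ) : ℝ)))
    (hτ : B + max (σ * √(2 * Real.log (16 * √r))) (16 * α * γ * √r / Real.pi) ≤ τ)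
    (hv : v = (1 - α) * σ ^ 2 + 4 * α * γ * τ / Real.pi) :
    averageNuclear μ f T X
      ≤ 2 * √(2 * L * r * Δ / T) + 4 * D * r ^ (3 / 2 : ℝ) * √(v / N) := by
  have hr1 : 1 ≤ r := by rw [hr]; exact_mod_cast lt_min hm hn
  have hr0 : 0 < r := by linarith
  have hT' : (0 : ℝ) < T := by exact_mod_cast hT
  have hΔ0 : 0 ≤ Δ := by linarith [ciInf_le hbdd x₀]
  rcases hΔ0.eq_or_lt with h0 | hΔ0
  · rw [← h0] at h
    simp only [mul_zero, zero_div, Real.sqrt_zero] at h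
    rw [h.averageNuclear_eq_zero hbdd (by linarith), hD]
    positivity
  set η := √(2 * Δ / (L * r * T)) with hη
  have hη0 : 0 < η := Real.sqrt_pos.2 (by positivity)
  have hη2 : η ^ 2 = 2 * Δ / (L * r * T) := Real.sq_sqrt (by positivity)
  -- The step size balances the two deterministic terms of the bound.
  have hS : √(2 * L * r * Δ / T) = L * r * η := by
    rw [Real.sqrt_eq_iff_eq_sq (by positivity) (by positivity), mul_pow, hη2]
    field_simp
  have hmain := h.mul_averageNuclear_le hf hL.le hbdd hΔ hη0.le hT hN hα hα' hσ hγ hr hr1 hB hτ hv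
  have hΔη : Δ = T * (L / 2 * η ^ 2 * r) := by
    rw [hη2]
    field_simp
  have hcoef : √r * √(m * n * (v / N)) = D * r ^ (3 / 2 : ℝ) * √(v / N) := by
    rw [Real.sqrt_mul (by positivity), ← mul_assoc, sqrt_mul_sqrt_card_eq hm hn hr hD]
  rw [hS]
  have hpos : 0 < η / 2 * T := by positivity
  refine le_of_mul_le_mul_left ?_ hpos
  calc η / 2 * T * averageNuclear μ f T X
      ≤ Δ + T * (2 * η * √r * √(m * n * (v / N)) + L / 2 * η ^ 2 * r) := by linarith
    _ = T * (2 * η * (√r * √(m * n * (v / N)))) + 2 * (T * (L / 2 * η ^ 2 * r)) := by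
        nth_rw 1 [hΔη]
        ring
    _ = η / 2 * T * (2 * (L * r * η) + 4 * D * r ^ (3 / 2 : ℝ) * √(v / N)) := by
        rw [hcoef]
        ring

end Run

/-- For large `T` and `N`, both terms of the rate are at most `ε / 2`. -/
lemma rate_le_of_le {L r Δ D v ε T N : ℝ} (hr : 0 < r) (hD : 0 ≤ D) (hT : 0 < T) (hN : 0 < N)
    (hε : 0 < ε) (hTε : 32 * L * r * Δ / ε ^ 2 ≤ T) (hNε : 64 * D ^ 2 * r ^ 3 * v / ε ^ 2 ≤ N) :
    2 * √(2 * L * r * Δ / T) + 4 * D * r ^ (3 / 2 : ℝ) * √(v / N) ≤ ε := by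
  rw [div_le_iff₀ (by positivity)] at hTε hNε
  have h1 : √(2 * L * r * Δ / T) ≤ ε / 4 := by
    apply Real.sqrt_le_iff.2 ⟨by positivity, ?_⟩
    rw [div_le_iff₀ hT]
    linarith
  have h2 : D * r ^ (3 / 2 : ℝ) * √(v / N) ≤ ε / 8 := by
    have hr3 : (r ^ (3 / 2 : ℝ)) ^ 2 = r ^ 3 := by
      rw [← Real.rpow_natCast, ← Real.rpow_mul hr.le, ← Real.rpow_natCast]
      norm_num
    have hc : D * r ^ (3 / 2 : ℝ) = √(D ^ 2 * r ^ 3) := by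
      rw [← hr3, ← mul_pow, Real.sqrt_sq (by positivity)]
    rw [hc, ← Real.sqrt_mul (by positivity)]
    apply Real.sqrt_le_iff.2 ⟨by positivity, ?_⟩
    rw [← mul_div_assoc, div_le_iff₀ hN]
    linarith
  linarith

lemma max_one_ceil_le {x : ℝ} (hx : 0 ≤ x) : ((max 1 ⌈x⌉₊ : ℕ) : ℝ) ≤ x + 1 := by
  rw [Nat.cast_max, Nat.cast_one]
  exact max_le (by linarith) (Nat.ceil_lt_add_one hx).le

/-- A sample count of order `(a ε⁻² + 1) (b ε⁻² + 1)` is `O(ε⁻⁴)` for small `ε`. -/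
lemma isBigO_inv_pow_four_of_le {F : ℝ → ℝ} {a b : ℝ} (ha : 0 ≤ a) (hb : 0 ≤ b)
    (hF0 : ∀ ε, 0 ≤ F ε) (hF : ∀ ε, 0 < ε → F ε ≤ (a / ε ^ 2 + 1) * (b / ε ^ 2 + 1)) :
    F =O[nhdsWithin 0 (Set.Ioi 0)] fun ε => (ε ^ 4)⁻¹ := by
  refine Asymptotics.IsBigO.of_bound ((a + 1) * (b + 1)) ?_
  filter_upwards [Ioo_mem_nhdsGT (zero_lt_one' ℝ)] with ε hε
  have h0 := hε.1
  have hsq : ε ^ 2 ≤ 1 := pow_le_one₀ h0.le hε.2.le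
  have key : ∀ c : ℝ, c / ε ^ 2 + 1 ≤ (c + 1) / ε ^ 2 := fun c => by
    rw [add_div]
    gcongr
    rwa [one_le_div (by positivity)]
  rw [Real.norm_of_nonneg (hF0 ε), Real.norm_of_nonneg (by positivity)]
  calc F ε ≤ (a / ε ^ 2 + 1) * (b / ε ^ 2 + 1) := hF ε h0
    _ ≤ (a + 1) / ε ^ 2 * ((b + 1) / ε ^ 2) :=
        mul_le_mul (key a) (key b) (by positivity) (by positivity)
    _ = (a + 1) * (b + 1) * (ε ^ 4)⁻¹ := by
        field_simp

theorem theorem4p3 {m n : ℕ} (hm : 0 < m) (hn : 0 < n)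
    (f : Matrix (Fin m) (Fin n) ℝ → ℝ) (x₀ : Matrix (Fin m) (Fin n) ℝ)
    (L Δ B α σ γ τ r D v : ℝ)
    (hL : 0 < L) (hf : IsFrobeniusSmooth L f)
    (hbdd : BddBelow (Set.range f)) (hΔ : Δ = f x₀ - ⨅ X, f X)
    (hB : 0 ≤ B) (hα : 0 ≤ α) (hα' : α ≤ 1) (hσ : 0 ≤ σ) (hγ : 0 < γ)
    (hr : r = ((min m n : ℕ) : ℝ))
    (hD : D = √(((max m n : ℕ) : ℝ) / ((min m n : ℕ) : ℝ)))
    (hτ : B + max (σ * √(2 * Real.log (16 * √r))) (16 * α * γ * √r / Real.pi) ≤ τ)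
    (hv : v = (1 - α) * σ ^ 2 + 4 * α * γ * τ / Real.pi) :
    -- the rate, and the accuracy guarantee for large `T` and `N`
    (∀ T N : ℕ, 0 < T → 0 < N →
      ∀ (Ω : Type*) [MeasurableSpace Ω] (μ : Measure Ω) [IsProbabilityMeasure μ]
        (X : ℕ → Ω → Matrix (Fin m) (Fin n) ℝ) (Ξ : ℕ → Fin N → Ω → Matrix (Fin m) (Fin n) ℝ),
        IsAdmissibleRun μ f x₀ B α σ γ τ (√(2 * Δ / (L * r * T))) T X Ξ →
        (∀ k < T, Integrable (fun ω => nuclearNorm (matrixGradient f (X k ω))) μ) ∧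
        averageNuclear μ f T X
          ≤ 2 * √(2 * L * r * Δ / T) + 4 * D * r ^ (3 / 2 : ℝ) * √(v / N) ∧
        ∀ ε : ℝ, 0 < ε → 32 * L * r * Δ / ε ^ 2 ≤ T → 64 * D ^ 2 * r ^ 3 * v / ε ^ 2 ≤ N →
          averageNuclear μ f T X ≤ ε) ∧
    -- the total number `T * N` of samples that suffices for accuracy `ε` is `O(ε⁻⁴)`
    (∃ T N : ℝ → ℕ,
      (∀ ε : ℝ, 0 < ε →
        0 < T ε ∧ 0 < N ε ∧
        ((T ε * N ε : ℕ) : ℝ)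
          ≤ (32 * L * r * Δ / ε ^ 2 + 1) * (64 * D ^ 2 * r ^ 3 * v / ε ^ 2 + 1) ∧
        ∀ (Ω : Type*) [MeasurableSpace Ω] (μ : Measure Ω) [IsProbabilityMeasure μ]
          (X : ℕ → Ω → Matrix (Fin m) (Fin n) ℝ)
          (Ξ : ℕ → Fin (N ε) → Ω → Matrix (Fin m) (Fin n) ℝ),
          IsAdmissibleRun μ f x₀ B α σ γ τ (√(2 * Δ / (L * r * T ε))) (T ε) X Ξ →
          averageNuclear μ f (T ε) X ≤ ε) ∧
      (fun ε : ℝ => ((T ε * N ε : ℕ) : ℝ)) =O[nhdsWithin 0 (Set.Ioi 0)]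
        (fun ε : ℝ => (ε ^ 4)⁻¹)) := by
  have hr0 : 0 < r := by rw [hr]; exact_mod_cast lt_min hm hn
  have hD0 : 0 ≤ D := by rw [hD]; exact Real.sqrt_nonneg _
  have hΔ0 : 0 ≤ Δ := by linarith [ciInf_le hbdd x₀]
  have hpi := Real.pi_pos
  have hτ0 : 0 ≤ τ := by
    have : 0 ≤ max (σ * √(2 * Real.log (16 * √r))) (16 * α * γ * √r / Real.pi) :=
      le_max_of_le_left (by positivity)
    linarith
  have hα1 : 0 ≤ 1 - α := by linarith
  have hv0 : 0 ≤ v := by rw [hv]; positivity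
  refine ⟨fun T N hT hN Ω _ μ _ X Ξ h => ?_, ?_⟩
  · have hrate := h.averageNuclear_le hm hn hf hL hbdd hΔ hT hN hB hα hα' hσ hγ hr hD hτ hv
    exact ⟨fun k hk => h.integrable_nuclearNorm hB hk, hrate, fun ε hε hTε hNε => hrate.trans
      (rate_le_of_le hr0 hD0 (by exact_mod_cast hT) (by exact_mod_cast hN) hε hTε hNε)⟩
  · have hcount : ∀ ε : ℝ, ((max 1 ⌈32 * L * r * Δ / ε ^ 2⌉₊
        * max 1 ⌈64 * D ^ 2 * r ^ 3 * v / ε ^ 2⌉₊ : ℕ) : ℝ)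
        ≤ (32 * L * r * Δ / ε ^ 2 + 1) * (64 * D ^ 2 * r ^ 3 * v / ε ^ 2 + 1) := fun ε => by
      rw [Nat.cast_mul]
      exact mul_le_mul (max_one_ceil_le (by positivity)) (max_one_ceil_le (by positivity))
        (by positivity) (by positivity)
    refine ⟨fun ε => max 1 ⌈32 * L * r * Δ / ε ^ 2⌉₊,
      fun ε => max 1 ⌈64 * D ^ 2 * r ^ 3 * v / ε ^ 2⌉₊, fun ε hε => ?_,
      isBigO_inv_pow_four_of_le (by positivity) (by positivity) (fun _ => Nat.cast_nonneg _)
        fun ε _ => hcount ε⟩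
    have hT : 0 < max 1 ⌈32 * L * r * Δ / ε ^ 2⌉₊ := by positivity
    have hN : 0 < max 1 ⌈64 * D ^ 2 * r ^ 3 * v / ε ^ 2⌉₊ := by positivity
    refine ⟨hT, hN, hcount ε, fun Ω _ μ _ X Ξ h => ?_⟩
    refine (h.averageNuclear_le hm hn hf hL hbdd hΔ hT hN hB hα hα' hσ hγ hr hD hτ hv).trans
      (rate_le_of_le hr0 hD0 (by exact_mod_cast hT) (by exact_mod_cast hN) hε ?_ ?_)
    · exact (Nat.le_ceil _).trans (by exact_mod_cast le_max_right _ _)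
    · exact (Nat.le_ceil _).trans (by exact_mod_cast le_max_right _ _)
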